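/- Let $d\ge 2$. Let $j:\mathbb{R}^d\to[0,\infty)$ be radial and radially non-increasing (on $\mathbb{R}^d\setminus\{0\}$) with $\int_{\mathbb{R}^d}(1\wedge|x|)\,j(x)\,dx<\infty$, and let $\phi:\mathbb{R}^d\to[0,\infty)$ be a Lebesgue measurable function with $\phi(x)=\phi(-x)$ and $\phi(x)\le j(x)$ for all $x\in\mathbb{R}^d$. Let $\mathfrak{C}$ be the class of sets $E\subset\mathbb{R}^d$ that are the closure of an open set with compact $C^2$ boundary (locally at each boundary point the open set is $\{g<0\}$ for a $C^2$ function $g$ with $\nabla g\neq0$). For $E\subset\mathbb{R}^d$ and $x\in\partial E$ put $$H_\phi(x,E)=\frac{1}{\kappa_{d-2}}\lim_{r\downarrow0}\int_{\mathbb{R}^d\setminus B_r(x)}\bigl(\chi_{E^c}(y)-\chi_E(y)\bigr)\phi(x-y)\,dy ,\qquad \kappa_{d-2}=\mathcal{H}^{d-2}(\mathbb{S}^{d-2}).$$ For $f:\mathbb{R}^d\to\mathbb{R}^d$ of class $C^2$ let $\|f\|_{C^2}=\sup|f|+\sup\|Df\|+\sup\|D^2f\|\in[0,\infty]$. Write $E_n\to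 E$ in $\mathfrak{C}$ if there are $C^2$ diffeomorphisms $\Phi_n$ of $\mathbb{R}^d$ with $\|\Phi_n-\mathrm{Id}\|_{C^2}\to0$ and $E_n=\Phi_n(E)$. A set $E$ satisfies the interior and exterior ball condition of radius $R$ at $x\in\partial E$ if there are open balls of radius $R$, one contained in $E$ and one contained in $E^c$, whose boundary spheres both contain $x$. A modulus of continuity is a non-decreasing function $\omega:[0,\infty]\to[0,\infty]$ with $\omega(0)=0$ and $\omega(t)\to0$ as $t\downarrow0$. Then for every $E\in\mathfrak{C}$ and $x\in\partial E$ the integrals in the definition of $H_\phi(x,E)$ converge absolutely and the limit exists and is finite, and the following hold. (M) Monotonicity: if $E,F\in\mathfrak{C}$, $E\subset F$ and $x\in\partial E\cap\partial F$, then $H_\phi(x,F)\le H_\phi(x,E)$. (T) Translation invariance: if $E\in\mathfrak{C}$, $x\in\partial E$ and $z\in\mathbb{R}^d$, then $H_\phi(x,E)=H_\phi(x+z,E+z)$. (C') Uniform continuity: for every $R>0$ there is a modulus of continuity $\omega_R$ (depending, besides $d$ and the fixed kernel $\phi$, only on $R$) such that for all $E\in\mathfrak{C}$ and $x\in\partial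 E$ such that $E$ satisfies the interior and exterior ball condition of radius $R$ at $x$, and for all $C^2$ diffeomorphisms $\Phi:\mathbb{R}^d\to\mathbb{R}^d$ with $\Phi(y)=y$ for $|y-x|\ge1$, $$|H_\phi(x,E)-H_\phi(\Phi(x),\Phi(E))|\le\omega_R\bigl(\|\Phi-\mathrm{Id}\|_{C^2}\bigr).$$ (C) Continuity: if $E\in\mathfrak{C}$, $E_n\to E$ in $\mathfrak{C}$, $x_n\in\partial E_n$, $x\in\partial E$ and $x_n\to x$, then $H_\phi(x_n,E_n)\to H_\phi(x,E)$. -/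

import Mathlib

open Set Filter Topology MeasureTheory
open scoped ENNReal Manifold

namespace NonlocalCurvature

/-- `ℝ^d` with its Euclidean norm. -/
abbrev Rd (d : ℕ) : Type := EuclideanSpace ℝ (Fin d)

/-- The profile `j : ℝ^d → [0, ∞)`: radial and radially non-increasing away from the origin
(the single value `j 0` plays no role), with `∫ (1 ∧ |x|) j(x) dx < ∞`.
The comparison for `‖x‖ = ‖y‖`, used in both directions, says that `j` is radial. -/
structure IsProfile {d : ℕ} (j : Rd d → ℝ) : Prop where
  nonneg : ∀ x, 0 ≤ j x
  radial_antitone : ∀ x y, x ≠ 0 → ‖x‖ ≤ ‖y‖ → j y ≤ j x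
  integrable : Integrable (fun x => min 1 ‖x‖ * j x)

/-- The kernel `φ : ℝ^d → [0, ∞)`: Lebesgue measurable, even and dominated by `j`. -/
structure IsKernel {d : ℕ} (j φ : Rd d → ℝ) : Prop where
  measurable : AEMeasurable φ volume
  nonneg : ∀ x, 0 ≤ φ x
  even : ∀ x, φ (-x) = φ x
  le_profile : ∀ x, φ x ≤ j x

/-- The surface area of the unit sphere of `ℝ^n`, that is `κ_{n-1} = ℋ^{n-1}(𝕊^{n-1})`
(for `n = 1` this is `2`). -/
noncomputable def sphereArea (n : ℕ) : ℝ :=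
  ((volume : Measure (Rd n)).toSphere).real univ

open Classical in
/-- `χ_{Eᶜ} - χ_E`. -/
noncomputable def signChi {d : ℕ} (E : Set (Rd d)) (y : Rd d) : ℝ :=
  if y ∈ E then -1 else 1

/-- The curvature with a ball of radius `r` around the point removed:
`κ_{d-2}⁻¹ ∫_{B_r(x)ᶜ} (χ_{Eᶜ} - χ_E)(y) φ(x - y) dy`. -/
noncomputable def truncCurvature {d : ℕ} (φ : Rd d → ℝ) (x : Rd d) (E : Set (Rd d)) (r : ℝ) : ℝ :=
  (sphereArea (d - 1))⁻¹ * ∫ y in (Metric.ball x r)ᶜ, signChi E y * φ (x - y)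

/-- The nonlocal mean curvature `H_φ(x, E)`, the limit as `r ↓ 0` of the truncated curvatures. -/
noncomputable def curvature {d : ℕ} (φ : Rd d → ℝ) (x : Rd d) (E : Set (Rd d)) : ℝ :=
  limUnder (𝓝[>] (0 : ℝ)) (truncCurvature φ x E)

/-- The open set `U` has boundary of class `C²`: near each boundary point it is the sublevel set
`{g < 0}` of a `C²` function `g` with non-vanishing differential at that point. -/
def HasC2Boundary {d : ℕ} (U : Set (Rd d)) : Prop :=
  ∀ p ∈ frontier U, ∃ g : Rd d → ℝ,
    ContDiffAt ℝ 2 g p ∧ fderiv ℝ g p ≠ 0 ∧ ∀ᶠ y in 𝓝 p, (y ∈ U ↔ g y < 0)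

/-- The class `ℭ` of closures of open sets with compact `C²` boundary. -/
def ClassC (d : ℕ) : Set (Set (Rd d)) :=
  {E | ∃ U : Set (Rd d), IsOpen U ∧ IsCompact (frontier U) ∧ HasC2Boundary U ∧ E = closure U}

/-- Interior and exterior ball condition of radius `R` for `E` at the point `x`. -/
def BallCondition {d : ℕ} (R : ℝ) (E : Set (Rd d)) (x : Rd d) : Prop :=
  (∃ c, dist x c = R ∧ Metric.ball c R ⊆ E) ∧ (∃ c, dist x c = R ∧ Metric.ball c R ⊆ Eᶜ)

/-- `C²` diffeomorphisms of `ℝ^d` onto itself. -/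
abbrev C2Diffeo (d : ℕ) : Type := Diffeomorph 𝓘(ℝ, Rd d) 𝓘(ℝ, Rd d) (Rd d) (Rd d) 2

/-- `‖f‖_{C²} = sup |f| + sup |Df| + sup |D²f|`, possibly infinite. -/
noncomputable def C2Norm {d : ℕ} (f : Rd d → Rd d) : ℝ≥0∞ :=
  ∑ k ∈ Finset.range 3, ⨆ y, ‖iteratedFDeriv ℝ k f y‖ₑ

/-- A modulus of continuity with values in `[0, ∞]`: non-decreasing, with limit `0 = ω 0` at `0`. -/
def IsModulus (ω : ℝ≥0∞ → ℝ≥0∞) : Prop :=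
  Monotone ω ∧ ω 0 = 0 ∧ Tendsto ω (𝓝 0) (𝓝 0)

/-- `E_n → E`: there are `C²` diffeomorphisms `Φ_n`, converging to the identity in `C²`, with
`E_n = Φ_n(E)`. -/
def SetTendsto {d : ℕ} (En : ℕ → Set (Rd d)) (E : Set (Rd d)) : Prop :=
  ∃ Φ : ℕ → C2Diffeo d,
    Tendsto (fun n => C2Norm (fun y => Φ n y - y)) atTop (𝓝 0) ∧ ∀ n, En n = Φ n '' E

end NonlocalCurvature

open NonlocalCurvature

/-! The singularity of the kernel is harmless because of a cancellation. Near a boundary point `x`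
the boundary of `E` lies in a paraboloidal slab `|⟨z, ν⟩| ≤ K|z|²` (`Pinched`). For `z` outside the
slab, `x + z` and `x - z` lie on opposite sides of the boundary. As `φ` is even, an annulus with
outer radius `ρ` therefore contributes at most the integral of `j` over the slab inside `B_ρ`.

The slab estimate `lintegral_slab_le` bounds that integral by `C K ∫_{B_ρ} |z| j`. By layer cake it
suffices to treat balls: the slab occupies volume of order `K s^{d+1}` in `B_s`, which is of order
`K ∫_{B_s} |z|`. The bound tends to `0` with `ρ` and depends on the set only through `K`. Hence the
truncated curvatures converge, uniformly over all sets pinched with the same constants.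

Monotonicity and translation invariance hold for each truncation and pass to the limit. Both
continuity statements split the curvature at a radius `ρ`. The near part is uniformly small, since a
small `C²` perturbation keeps a set pinched (`Pinched.image`). The far part has an integrable
kernel. For (C') it is handled by the change of variables along `Φ`, uniformly in `E`. For (C),
where `x_n` need not be the image of `x`, it is handled by dominated convergence, using that `∂E` is
Lebesgue null. -/

namespace NonlocalCurvature

/-! ### Integrals of radial profiles over paraboloidal slabs -/

section RadialIntegrals

variable {d : ℕ}

theorem volume_closedBall_inter_slab_le [NeZero d] {ν : Rd d} (hν : ‖ν‖ = 1) {s t : ℝ} (hs : 0 ≤ s)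
    (ht : 0 ≤ t) :
    volume (Metric.closedBall (0 : Rd d) s ∩ {z | |inner ℝ z ν| ≤ t}) ≤
      ENNReal.ofReal (2 * t * (2 * s) ^ (d - 1)) := by
  have hon : Orthonormal ℝ (({0} : Set (Fin d)).domRestrict fun _ => ν) := by
    refine ⟨fun i => hν, fun i j hij => (hij (Subsingleton.elim i j)).elim⟩
  obtain ⟨b, hb⟩ := hon.exists_orthonormalBasis_extension_of_card_eq (by simp)
  have hb0 : b 0 = ν := hb 0 rfl
  have hmp := (EuclideanSpace.volume_preserving_symm_measurableEquiv_toLp (Fin d)).comp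
    b.measurePreserving_repr
  -- In an orthonormal basis starting with `ν` the set lies in a box of half-width `t` along `ν` and
  -- `s` in the other directions.
  set w : Fin d → ℝ := fun i => if i = 0 then t else s with hw
  have hsub : Metric.closedBall (0 : Rd d) s ∩ {z | |inner ℝ z ν| ≤ t} ⊆
      ((MeasurableEquiv.toLp 2 (Fin d → ℝ)).symm ∘ b.repr) ⁻¹' Set.Icc (-w) w := by
    rintro z ⟨hz, hzt⟩
    have key : ∀ i, |b.repr z i| ≤ w i := by
      intro i
      by_cases hi : i = 0
      · subst hi
        simpa [hw, b.repr_apply_apply, hb0, real_inner_comm] using hzt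
      · simp only [hw, hi, if_false]
        calc |b.repr z i| ≤ ‖b.repr z‖ := PiLp.norm_apply_le (b.repr z) i
          _ = ‖z‖ := b.repr.norm_map z
          _ ≤ s := by simpa using hz
    exact ⟨fun i => (abs_le.1 (key i)).1, fun i => (abs_le.1 (key i)).2⟩
  refine (measure_mono hsub).trans ?_
  rw [hmp.measure_preimage measurableSet_Icc.nullMeasurableSet, Real.volume_Icc_pi]
  have hwi : ∀ i, 0 ≤ w i - (-w) i := fun i => by
    by_cases hi : i = 0 <;> simp [hw, hi] <;> linarith
  rw [← ENNReal.ofReal_prod_of_nonneg fun i _ => hwi i]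
  refine ENNReal.ofReal_le_ofReal (le_of_eq ?_)
  rw [← Finset.mul_prod_erase _ _ (Finset.mem_univ (0 : Fin d))]
  rw [Finset.prod_congr rfl (g := fun _ => 2 * s), Finset.prod_const,
    Finset.card_erase_of_mem (Finset.mem_univ _)]
  · simp [hw]; ring_nf; simp
  · intro i hi
    simp [hw, Finset.ne_of_mem_erase hi]; ring

/-- A bounded set which contains, with each of its points, all nonzero points of smaller norm. -/
theorem exists_radius_of_radial {A : Set (Rd d)} (hA : Bornology.IsBounded A)
    (hrad : ∀ x ∈ A, ∀ y, x ≠ 0 → y ≠ 0 → ‖y‖ ≤ ‖x‖ → y ∈ A) :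
    A ⊆ {0} ∨ ∃ s, 0 < s ∧ A ⊆ Metric.closedBall 0 s ∧ Metric.ball 0 s \ {0} ⊆ A := by
  by_cases hne : A ⊆ {0}
  · exact Or.inl hne
  right
  obtain ⟨a, ha, ha0⟩ := Set.not_subset.1 hne
  obtain ⟨C, hC⟩ := hA.exists_norm_le
  have hbdd : BddAbove (norm '' A) := ⟨C, by rintro _ ⟨x, hx, rfl⟩; exact hC x hx⟩
  refine ⟨sSup (norm '' A), ?_, ?_, ?_⟩
  · exact (norm_pos_iff.2 ha0).trans_le (le_csSup hbdd ⟨a, ha, rfl⟩)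
  · intro x hx
    simpa using le_csSup hbdd ⟨x, hx, rfl⟩
  · rintro y ⟨hy, hy0⟩
    obtain ⟨_, ⟨x, hx, rfl⟩, hxy⟩ :=
      exists_lt_of_lt_csSup (s := norm '' A) ⟨_, a, ha, rfl⟩ (by simpa using hy)
    exact hrad x hx y (norm_pos_iff.1 ((norm_nonneg y).trans_lt hxy)) hy0 hxy.le

/-- The constant comparing the measure of a paraboloidal neighbourhood of a hyperplane in a ball
with the first moment of the ball. -/
noncomputable def slabConst (d : ℕ) : ℝ≥0∞ :=
  ENNReal.ofReal (2 ^ d * 4 ^ (d + 1)) / volume (Metric.ball (0 : Rd d) 1)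

theorem slabConst_ne_top : slabConst d ≠ ∞ :=
  (ENNReal.div_lt_top ENNReal.ofReal_ne_top (Metric.measure_ball_pos _ _ one_pos).ne').ne

theorem exists_norm_eq_of_nonneg [NeZero d] {s : ℝ} (hs : 0 ≤ s) : ∃ c : Rd d, ‖c‖ = s := by
  have : Nontrivial (Rd d) := inferInstance
  exact exists_norm_eq _ hs

/-- Up to the origin and the bounding sphere, `A` is a ball of some radius `s`. The slab part has
volume at most `2^d K s^{d+1}`, while the first moment of `A` is at least `(s/4)^{d+1}|B_1|`;
`slabConst` is the ratio. -/
theorem volume_slab_le_mul_lintegral_norm [NeZero d] {ν : Rd d} (hν : ‖ν‖ = 1) {K : ℝ} (hK : 0 ≤ K)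
    {A : Set (Rd d)} (hA : Bornology.IsBounded A)
    (hrad : ∀ x ∈ A, ∀ y, x ≠ 0 → y ≠ 0 → ‖y‖ ≤ ‖x‖ → y ∈ A) :
    volume (A ∩ {z | |inner ℝ z ν| ≤ K * ‖z‖ ^ 2}) ≤
      ENNReal.ofReal K * slabConst d * ∫⁻ z in A, ENNReal.ofReal ‖z‖ := by
  rcases exists_radius_of_radial hA hrad with h0 | ⟨s, hs, hsub, hsup⟩
  · have : volume (A ∩ {z | |inner ℝ z ν| ≤ K * ‖z‖ ^ 2}) = 0 :=
      measure_mono_null (inter_subset_left.trans h0) (measure_singleton _)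
    rw [this]
    exact zero_le
  have hω := Metric.measure_ball_pos (volume : Measure (Rd d)) 0 one_pos
  have hω' : volume (Metric.ball (0 : Rd d) 1) ≠ ∞ := Metric.isBounded_ball.measure_lt_top.ne
  have hup : volume (A ∩ {z | |inner ℝ z ν| ≤ K * ‖z‖ ^ 2}) ≤
      ENNReal.ofReal K * ENNReal.ofReal (2 ^ d * s ^ (d + 1)) := by
    refine (measure_mono (t := Metric.closedBall (0 : Rd d) s ∩ {z | |inner ℝ z ν| ≤ K * s ^ 2})
      ?_).trans ((volume_closedBall_inter_slab_le hν hs.le (by positivity)).trans ?_)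
    · rintro z ⟨hz, hzt⟩
      have : ‖z‖ ≤ s := by simpa using hsub hz
      exact ⟨hsub hz, (show |inner ℝ z ν| ≤ K * ‖z‖ ^ 2 from hzt).trans (by gcongr)⟩
    · rw [← ENNReal.ofReal_mul hK]
      refine ENNReal.ofReal_le_ofReal (le_of_eq ?_)
      obtain ⟨n, rfl⟩ := Nat.exists_eq_succ_of_ne_zero (NeZero.ne d)
      simp only [Nat.succ_eq_add_one, Nat.add_sub_cancel]
      rw [mul_pow]; ring
  -- The ball of radius `s/4` about a point of norm `s/2` avoids the origin, so it lies in `A`, and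
  -- `|z| > s/4` on it.
  obtain ⟨c, hc⟩ := exists_norm_eq_of_nonneg (d := d) (s := s / 2) (by positivity)
  have hcn : ∀ z ∈ Metric.ball c (s / 4), s / 4 < ‖z‖ ∧ ‖z‖ < s := by
    intro z hz
    rw [mem_ball_iff_norm] at hz
    have h1 := norm_sub_norm_le c z
    have h2 := norm_sub_norm_le z c
    rw [norm_sub_rev] at h1
    constructor <;> linarith
  have hlow : ENNReal.ofReal ((s / 4) ^ (d + 1)) * volume (Metric.ball (0 : Rd d) 1) ≤
      ∫⁻ z in A, ENNReal.ofReal ‖z‖ := by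
    calc ENNReal.ofReal ((s / 4) ^ (d + 1)) * volume (Metric.ball (0 : Rd d) 1)
        = ENNReal.ofReal (s / 4) * volume (Metric.ball c (s / 4)) := by
          rw [Measure.addHaar_ball _ c (by positivity), ← mul_assoc,
            ← ENNReal.ofReal_mul (by positivity), finrank_euclideanSpace_fin, pow_succ']
      _ = ∫⁻ z in Metric.ball c (s / 4), ENNReal.ofReal (s / 4) := by simp
      _ ≤ ∫⁻ z in Metric.ball c (s / 4), ENNReal.ofReal ‖z‖ :=
          setLIntegral_mono' measurableSet_ball fun z hz =>
            ENNReal.ofReal_le_ofReal (hcn z hz).1.le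
      _ ≤ ∫⁻ z in A, ENNReal.ofReal ‖z‖ := by
          refine lintegral_mono_set fun z hz => hsup ⟨by simpa using (hcn z hz).2, ?_⟩
          rintro rfl
          have := (hcn _ hz).1
          simp at this
          linarith
  refine hup.trans ?_
  rw [mul_assoc]
  gcongr
  refine le_trans (le_of_eq ?_) (mul_le_mul_right hlow (slabConst d))
  rw [slabConst, mul_comm (ENNReal.ofReal ((s / 4) ^ (d + 1))), ← mul_assoc,
    ENNReal.div_mul_cancel hω.ne' hω', ← ENNReal.ofReal_mul (by positivity)]
  congr 1
  rw [div_pow]; field_simp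

/-- Layer cake on both sides: each superlevel set of `j` inside `B_ρ` is radial, so the estimate for
sets applies level by level. -/
theorem lintegral_slab_le [NeZero d] {j : Rd d → ℝ} (hj : IsProfile j)
    (hm : AEMeasurable j volume) {ν : Rd d} (hν : ‖ν‖ = 1) {K : ℝ} (hK : 0 ≤ K) (ρ : ℝ) :
    ∫⁻ z in Metric.ball 0 ρ ∩ {z | |inner ℝ z ν| ≤ K * ‖z‖ ^ 2}, ENNReal.ofReal (j z) ≤
      ENNReal.ofReal K * slabConst d *
        ∫⁻ z in Metric.ball 0 ρ, ENNReal.ofReal ‖z‖ * ENNReal.ofReal (j z) := by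
  set P : Set (Rd d) := {z | |inner ℝ z ν| ≤ K * ‖z‖ ^ 2}
  have hP : MeasurableSet P := by
    apply measurableSet_le <;> fun_prop
  have hb : MeasurableSet (Metric.ball (0 : Rd d) ρ) := measurableSet_ball
  set f : Rd d → ℝ := (Metric.ball 0 ρ).indicator j
  have hf0 : ∀ z, 0 ≤ f z := fun z => Set.indicator_nonneg (fun x _ => hj.nonneg x) z
  have hfm : AEMeasurable f volume := hm.indicator hb
  have hofReal : ∀ z, ENNReal.ofReal (f z) =
      (Metric.ball 0 ρ).indicator (fun z => ENNReal.ofReal (j z)) z := fun z => by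
    by_cases hz : z ∈ Metric.ball (0 : Rd d) ρ <;> simp [f, hz, -Metric.mem_ball]
  have hnm : Measurable fun z : Rd d => ENNReal.ofReal ‖z‖ := by fun_prop
  -- With density `|z|`, the first moment of `j` also becomes an integral of measures of superlevel
  -- sets.
  set μ : Measure (Rd d) := volume.withDensity fun z => ENNReal.ofReal ‖z‖
  have hfμ : AEMeasurable f μ := hfm.mono_ac (withDensity_absolutelyContinuous _ _)
  have hL : ∫⁻ z in Metric.ball 0 ρ ∩ P, ENNReal.ofReal (j z) =
      ∫⁻ z in P, ENNReal.ofReal (f z) := by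
    simp_rw [hofReal]
    rw [lintegral_indicator hb, Measure.restrict_restrict hb]
  have hR : ∫⁻ z in Metric.ball 0 ρ, ENNReal.ofReal ‖z‖ * ENNReal.ofReal (j z) =
      ∫⁻ z, ENNReal.ofReal (f z) ∂μ := by
    rw [lintegral_withDensity_eq_lintegral_mul_non_measurable₀ _ hnm.aemeasurable
      (ae_of_all _ fun z => ENNReal.ofReal_lt_top), ← lintegral_indicator hb]
    congr 1 with z
    rw [Pi.mul_apply, hofReal]
    by_cases hz : z ∈ Metric.ball (0 : Rd d) ρ <;> simp [hz, -Metric.mem_ball]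
  rw [hL, hR, lintegral_eq_lintegral_meas_lt _ (ae_of_all _ hf0) hfm.restrict,
    lintegral_eq_lintegral_meas_lt _ (ae_of_all _ hf0) hfμ,
    ← lintegral_const_mul' _ _ (ENNReal.mul_ne_top ENNReal.ofReal_ne_top slabConst_ne_top)]
  refine setLIntegral_mono' measurableSet_Ioi fun t ht => ?_
  have ht0 : (0 : ℝ) < t := ht
  rw [Measure.restrict_apply' hP, withDensity_apply']
  have hball : {z | t < f z} ⊆ Metric.ball 0 ρ := by
    intro z hz
    by_contra hzb
    simp only [mem_ofPred_eq, f, Set.indicator_of_notMem hzb] at hz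
    linarith
  refine volume_slab_le_mul_lintegral_norm hν hK (Metric.isBounded_ball.subset hball) ?_
  intro x hx y hx0 hy0 hyx
  have hxb := hball hx
  have hyb : y ∈ Metric.ball (0 : Rd d) ρ := by
    simp only [Metric.mem_ball, dist_zero_right] at hxb ⊢
    linarith
  simp only [mem_ofPred_eq, f, Set.indicator_of_mem hxb, Set.indicator_of_mem hyb] at hx ⊢
  exact hx.trans_le (hj.radial_antitone y x hy0 hyx)

end RadialIntegrals

/-! ### Cancellation near the singularity and convergence of the truncations -/

section Truncation

variable {d : ℕ} {j φ : Rd d → ℝ} {E : Set (Rd d)} {x : Rd d} {K r₀ : ℝ}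

/-- Near `x`, the boundary of `E` lies between two paraboloids touching at `x`. -/
def Pinched (K r₀ : ℝ) (E : Set (Rd d)) (x : Rd d) : Prop :=
  ∃ ν : Rd d, ‖ν‖ = 1 ∧ ∀ z, ‖z‖ < r₀ →
    (K * ‖z‖ ^ 2 < inner ℝ z ν → x + z ∉ E) ∧ (inner ℝ z ν < -(K * ‖z‖ ^ 2) → x + z ∈ E)

theorem abs_signChi (E : Set (Rd d)) (y : Rd d) : |signChi E y| = 1 := by
  unfold signChi; split_ifs <;> simp

theorem signChi_of_mem {y : Rd d} (h : y ∈ E) : signChi E y = -1 := if_pos h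

theorem signChi_of_notMem {y : Rd d} (h : y ∉ E) : signChi E y = 1 := if_neg h

theorem measurable_signChi (hE : MeasurableSet E) : Measurable (signChi E) := by
  classical
  exact Measurable.ite hE measurable_const measurable_const

theorem signChi_anti {E F : Set (Rd d)} (h : E ⊆ F) (y : Rd d) : signChi F y ≤ signChi E y := by
  by_cases hE : y ∈ E
  · rw [signChi_of_mem hE, signChi_of_mem (h hE)]
  · rw [signChi_of_notMem hE]
    exact (le_abs_self _).trans (abs_signChi F y).le

theorem sphereArea_inv_nonneg (n : ℕ) : 0 ≤ (sphereArea n)⁻¹ :=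
  inv_nonneg.2 measureReal_nonneg

/-- Measurability of `j` is recovered from the integrability of `(1 ∧ |x|) j` by dividing by the
weight, which vanishes only at the origin. -/
theorem IsProfile.aemeasurable [NeZero d] (hj : IsProfile j) : AEMeasurable j volume := by
  have h : AEMeasurable (fun x : Rd d => (min 1 ‖x‖)⁻¹ * (min 1 ‖x‖ * j x)) volume := by
    refine AEMeasurable.mul ?_ hj.integrable.aemeasurable
    exact Measurable.aemeasurable (by fun_prop)
  refine h.congr ?_
  have h0 : ∀ᵐ x : Rd d, x ≠ 0 := by simp [ae_iff]
  filter_upwards [h0] with x hx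
  have : 0 < min 1 ‖x‖ := lt_min one_pos (norm_pos_iff.2 hx)
  field_simp

theorem IsKernel.integrableOn [NeZero d] (hj : IsProfile j) (hφ : IsKernel j φ) {r : ℝ}
    (hr : 0 < r) :
    IntegrableOn φ (Metric.ball 0 r)ᶜ := by
  have h : Integrable (fun x => (min 1 r)⁻¹ * (min 1 ‖x‖ * j x)) volume :=
    hj.integrable.const_mul _
  refine h.integrableOn.mono' hφ.measurable.aestronglyMeasurable.restrict ?_
  refine (ae_restrict_iff' measurableSet_ball.compl).2 (ae_of_all _ fun x hx => ?_)
  have hx' : r ≤ ‖x‖ := by simpa using hx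
  rw [Real.norm_of_nonneg (hφ.nonneg x)]
  refine (hφ.le_profile x).trans ?_
  have h1 : 0 < min 1 r := lt_min one_pos hr
  rw [← div_eq_inv_mul, le_div_iff₀ h1, mul_comm]
  exact mul_le_mul_of_nonneg_right (min_le_min_left _ hx') (hj.nonneg x)

theorem integrableOn_signChi_mul [NeZero d] (hj : IsProfile j) (hφ : IsKernel j φ)
    (hE : MeasurableSet E) (x : Rd d) {r : ℝ} (hr : 0 < r) :
    IntegrableOn (fun z => signChi E (x + z) * φ z) (Metric.ball 0 r)ᶜ := by
  refine (hφ.integrableOn hj hr).bdd_mul (c := 1) ?_ ?_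
  · exact ((measurable_signChi hE).comp (measurable_const_add x)).aestronglyMeasurable
  · exact ae_of_all _ fun z => (abs_signChi E _).le

theorem preimage_add_left_compl_ball (x : Rd d) (r : ℝ) :
    (fun z => x + z) ⁻¹' (Metric.ball x r)ᶜ = (Metric.ball 0 r)ᶜ := by
  ext z; simp

theorem IsKernel.comp_add (hφ : IsKernel j φ) (E : Set (Rd d)) (x : Rd d) :
    (fun y => signChi E y * φ (x - y)) ∘ (fun z => x + z) =
      fun z => signChi E (x + z) * φ z := by
  ext z
  simp [hφ.even]

theorem integrableOn_signChi_mul_sub [NeZero d] (hj : IsProfile j) (hφ : IsKernel j φ)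
    (hE : MeasurableSet E) (x : Rd d) {r : ℝ} (hr : 0 < r) :
    IntegrableOn (fun y => signChi E y * φ (x - y)) (Metric.ball x r)ᶜ := by
  rw [← (measurePreserving_add_left volume x).integrableOn_comp_preimage
    (measurableEmbedding_addLeft x), hφ.comp_add, preimage_add_left_compl_ball]
  exact integrableOn_signChi_mul hj hφ hE x hr

theorem IsKernel.truncCurvature_eq (hφ : IsKernel j φ) (E : Set (Rd d)) (x : Rd d) (r : ℝ) :
    truncCurvature φ x E r =
      (sphereArea (d - 1))⁻¹ * ∫ z in (Metric.ball 0 r)ᶜ, signChi E (x + z) * φ z := by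
  rw [truncCurvature, ← (measurePreserving_add_left volume x).setIntegral_preimage_emb
    (measurableEmbedding_addLeft x), preimage_add_left_compl_ball]
  exact congrArg _ (congrArg _ (hφ.comp_add E x))

theorem truncCurvature_translate (E : Set (Rd d)) (x z : Rd d) :
    truncCurvature φ (x + z) ((fun y => y + z) '' E) = truncCurvature φ x E := by
  ext r
  rw [truncCurvature, truncCurvature,
    ← (measurePreserving_add_right volume z).setIntegral_preimage_emb
    (measurableEmbedding_addRight z)]
  congr 2
  · congr 2
    ext y; simp
  · ext y
    have h : y + z ∈ (fun y => y + z) '' E ↔ y ∈ E := (add_left_injective z).mem_set_image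
    rw [add_sub_add_right_eq_sub]
    by_cases hy : y ∈ E
    · rw [signChi_of_mem hy, signChi_of_mem (h.2 hy)]
    · rw [signChi_of_notMem hy, signChi_of_notMem (mt h.1 hy)]

theorem truncCurvature_anti [NeZero d] (hj : IsProfile j) (hφ : IsKernel j φ) {E F : Set (Rd d)}
    (hE : MeasurableSet E) (hF : MeasurableSet F) (h : E ⊆ F) (x : Rd d) {r : ℝ} (hr : 0 < r) :
    truncCurvature φ x F r ≤ truncCurvature φ x E r := by
  refine mul_le_mul_of_nonneg_left ?_ (sphereArea_inv_nonneg _)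
  refine integral_mono (integrableOn_signChi_mul_sub hj hφ hF x hr)
    (integrableOn_signChi_mul_sub hj hφ hE x hr) fun y => ?_
  exact mul_le_mul_of_nonneg_right (signChi_anti h y) (hφ.nonneg _)

/-- Outside the slab one of `x + z`, `x - z` is in `E` and the other is not, so the signs cancel. -/
theorem Pinched.abs_signChi_add_le {ν : Rd d}
    (h : ∀ z, ‖z‖ < r₀ →
      (K * ‖z‖ ^ 2 < inner ℝ z ν → x + z ∉ E) ∧ (inner ℝ z ν < -(K * ‖z‖ ^ 2) → x + z ∈ E))
    {z : Rd d} (hz : ‖z‖ < r₀) :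
    |signChi E (x + z) + signChi E (x + -z)| ≤
      {z : Rd d | |inner ℝ z ν| ≤ K * ‖z‖ ^ 2}.indicator (fun _ => (2 : ℝ)) z := by
  have hz' : ‖-z‖ < r₀ := by rwa [norm_neg]
  have h1 := h z hz
  have h2 := h (-z) hz'
  rw [norm_neg, inner_neg_left] at h2
  by_cases hP : |inner ℝ z ν| ≤ K * ‖z‖ ^ 2
  · rw [Set.indicator_of_mem (by exact hP)]
    refine (abs_add_le _ _).trans ?_
    rw [abs_signChi, abs_signChi]; norm_num
  · rw [Set.indicator_of_notMem (by exact hP)]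
    rcases lt_abs.1 (not_le.1 hP) with hlt | hlt
    · rw [signChi_of_notMem (h1.1 hlt), signChi_of_mem (h2.2 (by linarith))]; simp
    · rw [signChi_of_mem (h1.2 (by linarith)), signChi_of_notMem (h2.1 hlt)]; simp

theorem Pinched.ofReal_abs_setIntegral_le [NeZero d] (hj : IsProfile j) (hφ : IsKernel j φ)
    (hE : MeasurableSet E) (hK : 0 ≤ K) (hP : Pinched K r₀ E x) {r ρ : ℝ} (hr : 0 < r)
    (hρ : ρ ≤ r₀) :
    ENNReal.ofReal |∫ z in Metric.ball 0 ρ \ Metric.ball 0 r, signChi E (x + z) * φ z| ≤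
      ENNReal.ofReal K * slabConst d *
        ∫⁻ z in Metric.ball 0 ρ, ENNReal.ofReal ‖z‖ * ENNReal.ofReal (j z) := by
  obtain ⟨ν, hν, h⟩ := hP
  set D : Set (Rd d) := Metric.ball 0 ρ \ Metric.ball 0 r
  have hD : MeasurableSet D := measurableSet_ball.diff measurableSet_ball
  set P : Set (Rd d) := {z | |inner ℝ z ν| ≤ K * ‖z‖ ^ 2}
  have hPm : MeasurableSet P := by
    apply measurableSet_le <;> fun_prop
  have hDneg : Neg.neg ⁻¹' D = D := by ext z; simp [D]
  have hint : IntegrableOn (fun z => signChi E (x + z) * φ z) D :=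
    (integrableOn_signChi_mul hj hφ hE x hr).mono_set fun z hz => hz.2
  have hmp := Measure.measurePreserving_neg (volume : Measure (Rd d))
  have hemb : MeasurableEmbedding (Neg.neg : Rd d → Rd d) := (MeasurableEquiv.neg _).measurableEmbedding
  have hcomp : (fun z => signChi E (x + z) * φ z) ∘ (Neg.neg : Rd d → Rd d) =
      fun z => signChi E (x + -z) * φ z := by
    ext z; simp [hφ.even]
  have hint' : IntegrableOn (fun z => signChi E (x + -z) * φ z) D := by
    rw [← hmp.integrableOn_comp_preimage hemb, hDneg, hcomp] at hint
    exact hint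
  have heq : ∫ z in D, signChi E (x + -z) * φ z = ∫ z in D, signChi E (x + z) * φ z := by
    rw [← hmp.setIntegral_preimage_emb hemb (fun z => signChi E (x + z) * φ z), hDneg]
    exact congrArg _ hcomp.symm
  -- The annulus is symmetric and `φ` is even, so the integrand may be averaged with its reflection.
  have h2 : ∫ z in D, signChi E (x + z) * φ z =
      ∫ z in D, 2⁻¹ * ((signChi E (x + z) + signChi E (x + -z)) * φ z) := by
    rw [integral_const_mul]
    simp_rw [add_mul]
    rw [integral_add hint hint', heq]; ring
  rw [h2, ← Real.norm_eq_abs, ofReal_norm]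
  refine (enorm_integral_le_lintegral_enorm _).trans (le_trans ?_
    (lintegral_slab_le hj hj.aemeasurable hν hK ρ))
  rw [Set.inter_comm, ← Measure.restrict_restrict hPm, ← lintegral_indicator hPm]
  refine le_trans (setLIntegral_mono' hD (g := P.indicator fun z => ENNReal.ofReal (j z))
    fun z hz => ?_) (lintegral_mono_set fun z hz => hz.1)
  have hz0 : ‖z‖ < r₀ := by
    have : ‖z‖ < ρ := by simpa using hz.1
    linarith
  have hb := Pinched.abs_signChi_add_le h hz0
  rw [← ofReal_norm, Real.norm_eq_abs, abs_mul, abs_mul, abs_of_nonneg (hφ.nonneg z)]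
  by_cases hzP : z ∈ P
  · rw [Set.indicator_of_mem hzP]
    refine ENNReal.ofReal_le_ofReal ?_
    rw [Set.indicator_of_mem hzP] at hb
    have := hφ.le_profile z
    have h0 := hφ.nonneg z
    rw [abs_of_pos (by norm_num : (0 : ℝ) < 2⁻¹)]
    nlinarith
  · rw [Set.indicator_of_notMem hzP] at hb ⊢
    rw [le_antisymm hb (abs_nonneg _)]
    simp

theorem IsProfile.tendsto_setLIntegral_ball [NeZero d] (hj : IsProfile j) :
    Tendsto (fun ρ => ∫⁻ z in Metric.ball (0 : Rd d) ρ, ENNReal.ofReal ‖z‖ * ENNReal.ofReal (j z))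
      (𝓝[>] 0) (𝓝 0) := by
  have hfin : ∫⁻ z, ENNReal.ofReal (min 1 ‖z‖ * j z) ≠ ∞ := by
    refine (lt_of_le_of_lt ?_ hj.integrable.2).ne
    exact lintegral_mono fun z => by
      rw [← ofReal_norm]
      exact ENNReal.ofReal_le_ofReal (le_abs_self _)
  have hvol : Tendsto (fun ρ : ℝ => volume (Metric.ball (0 : Rd d) ρ)) (𝓝[>] 0) (𝓝 0) := by
    have h : Tendsto (fun ρ : ℝ => ENNReal.ofReal (ρ ^ d) * volume (Metric.ball (0 : Rd d) 1))
        (𝓝[>] 0) (𝓝 (ENNReal.ofReal (0 ^ d) * volume (Metric.ball (0 : Rd d) 1))) := by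
      refine ENNReal.Tendsto.mul_const ?_ (Or.inr Metric.isBounded_ball.measure_lt_top.ne)
      refine ENNReal.tendsto_ofReal (Tendsto.mono_left ?_ nhdsWithin_le_nhds)
      exact (continuous_pow d).tendsto 0
    rw [zero_pow (NeZero.ne d), ENNReal.ofReal_zero, zero_mul] at h
    refine h.congr' ?_
    filter_upwards [self_mem_nhdsWithin] with ρ hρ
    rw [Measure.addHaar_ball _ (0 : Rd d) (le_of_lt hρ), finrank_euclideanSpace_fin]
  refine (tendsto_setLIntegral_zero hfin hvol).congr' ?_
  filter_upwards [Ioo_mem_nhdsGT (show (0 : ℝ) < 1 from one_pos)] with ρ hρ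
  refine setLIntegral_congr_fun measurableSet_ball fun z hz => ?_
  have : ‖z‖ < ρ := by simpa using hz
  rw [min_eq_right (this.le.trans hρ.2.le), ENNReal.ofReal_mul (norm_nonneg _)]

/-- The contribution of small distances is uniformly small over all pinched sets. -/
theorem exists_abs_truncCurvature_sub_le [NeZero d] (hj : IsProfile j) (hφ : IsKernel j φ)
    (hK : 0 ≤ K) (hr₀ : 0 < r₀) {ε : ℝ} (hε : 0 < ε) :
    ∃ ρ₀ > 0, ∀ E : Set (Rd d), MeasurableSet E → ∀ x, Pinched K r₀ E x →
      ∀ ρ ∈ Ioc 0 ρ₀, ∀ r ∈ Ioc 0 ρ, |truncCurvature φ x E r - truncCurvature φ x E ρ| ≤ ε := by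
  set c := (sphereArea (d - 1))⁻¹
  have hc : 0 ≤ c := sphereArea_inv_nonneg _
  have hlim := ENNReal.Tendsto.const_mul (a := ENNReal.ofReal c * (ENNReal.ofReal K * slabConst d))
    hj.tendsto_setLIntegral_ball (Or.inr (ENNReal.mul_ne_top ENNReal.ofReal_ne_top
      (ENNReal.mul_ne_top ENNReal.ofReal_ne_top slabConst_ne_top)))
  rw [mul_zero] at hlim
  have hev : ∀ᶠ ρ in 𝓝[>] (0 : ℝ), _ := hlim.eventually (ge_mem_nhds (ENNReal.ofReal_pos.2 hε))
  obtain ⟨ρ₁, hρ₁, hb⟩ := mem_nhdsGT_iff_exists_Ioc_subset.1 hev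
  refine ⟨min ρ₁ r₀, lt_min hρ₁ hr₀, fun E hE x hP ρ hρ r hr => ?_⟩
  have hρb := hb ⟨hρ.1, hρ.2.trans (min_le_left _ _)⟩
  have hle := hP.ofReal_abs_setIntegral_le hj hφ hE hK hr.1 (hρ.2.trans (min_le_right _ _))
  have hsub : (Metric.ball (0 : Rd d) ρ)ᶜ ⊆ (Metric.ball 0 r)ᶜ :=
    compl_subset_compl.2 (Metric.ball_subset_ball hr.2)
  have hdiff : (Metric.ball (0 : Rd d) r)ᶜ \ (Metric.ball 0 ρ)ᶜ =
      Metric.ball 0 ρ \ Metric.ball 0 r := by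
    ext z; simp [and_comm]
  have h1 := setIntegral_sdiff measurableSet_ball.compl
    (integrableOn_signChi_mul hj hφ hE x hr.1) hsub
  rw [hdiff] at h1
  rw [hφ.truncCurvature_eq, hφ.truncCurvature_eq, ← mul_sub, ← h1, abs_mul, abs_of_nonneg hc,
    ← ENNReal.ofReal_le_ofReal_iff hε.le, ENNReal.ofReal_mul hc]
  refine le_trans ?_ hρb
  rw [mul_assoc]
  gcongr

theorem Pinched.tendsto_truncCurvature [NeZero d] (hj : IsProfile j) (hφ : IsKernel j φ)
    (hK : 0 ≤ K) (hr₀ : 0 < r₀) (hE : MeasurableSet E) (hP : Pinched K r₀ E x) :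
    Tendsto (truncCurvature φ x E) (𝓝[>] 0) (𝓝 (curvature φ x E)) := by
  -- `curvature` is a `limUnder`, so only existence of the limit is needed, which follows from the
  -- Cauchy property.
  refine tendsto_nhds_limUnder (cauchy_map_iff_exists_tendsto.1 ?_)
  refine Metric.cauchy_iff.2 ⟨inferInstance, fun ε hε => ?_⟩
  obtain ⟨ρ, hρ, h⟩ := exists_abs_truncCurvature_sub_le hj hφ hK hr₀ (show 0 < ε / 3 by positivity)
  refine ⟨_, image_mem_map (Ioc_mem_nhdsGT hρ), ?_⟩
  rintro _ ⟨r, hr, rfl⟩ _ ⟨s, hs, rfl⟩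
  have h1 := h E hE x hP ρ ⟨hρ, le_rfl⟩ r hr
  have h2 := h E hE x hP ρ ⟨hρ, le_rfl⟩ s hs
  rw [Real.dist_eq]
  rw [abs_le] at h1 h2
  rw [abs_lt]
  constructor <;> linarith

theorem exists_abs_curvature_sub_truncCurvature_le [NeZero d] (hj : IsProfile j)
    (hφ : IsKernel j φ) (hK : 0 ≤ K) (hr₀ : 0 < r₀) {ε : ℝ} (hε : 0 < ε) :
    ∃ ρ > 0, ∀ E : Set (Rd d), MeasurableSet E → ∀ x, Pinched K r₀ E x →
      |curvature φ x E - truncCurvature φ x E ρ| ≤ ε := by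
  obtain ⟨ρ, hρ, h⟩ := exists_abs_truncCurvature_sub_le hj hφ hK hr₀ hε
  refine ⟨ρ, hρ, fun E hE x hP => ?_⟩
  refine le_of_tendsto ((hP.tendsto_truncCurvature hj hφ hK hr₀ hE).sub_const _).abs ?_
  filter_upwards [Ioc_mem_nhdsGT hρ] with r hr
  exact h E hE x hP ρ ⟨hρ, le_rfl⟩ r hr

end Truncation

/-! ### Which sets are pinched, and why their boundaries are null -/

section PinchedSets

variable {d : ℕ} {E : Set (Rd d)} {x : Rd d} {K r₀ : ℝ}

/-- Allows normals that are not of unit length; normalising costs a factor `1/m`. -/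
theorem pinched_of_vector {v : Rd d} {m : ℝ} (hm : 0 < m) (hv : m ≤ ‖v‖) (hK : 0 ≤ K)
    (h : ∀ z, ‖z‖ < r₀ →
      (K * ‖z‖ ^ 2 < inner ℝ z v → x + z ∉ E) ∧ (inner ℝ z v < -(K * ‖z‖ ^ 2) → x + z ∈ E)) :
    Pinched (K / m) r₀ E x := by
  have hv0 : 0 < ‖v‖ := hm.trans_le hv
  refine ⟨‖v‖⁻¹ • v, ?_, fun z hz => ?_⟩
  · rw [norm_smul, norm_inv, norm_norm, inv_mul_cancel₀ hv0.ne']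
  have hle : K * ‖z‖ ^ 2 ≤ K / m * ‖z‖ ^ 2 * ‖v‖ := by
    have h1 : K * ‖z‖ ^ 2 = K / m * ‖z‖ ^ 2 * m := by field_simp
    rw [h1]
    gcongr
  have hin : inner ℝ z (‖v‖⁻¹ • v) = inner ℝ z v / ‖v‖ := by
    rw [real_inner_smul_right]; ring
  rw [hin]
  constructor
  · intro hlt
    rw [lt_div_iff₀ hv0] at hlt
    exact (h z hz).1 (hle.trans_lt hlt)
  · intro hlt
    rw [div_lt_iff₀ hv0] at hlt
    exact (h z hz).2 (by linarith)

theorem Pinched.mono (h : Pinched K r₀ E x) {K' r₁ : ℝ} (hK : K ≤ K') (hr : r₁ ≤ r₀) :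
    Pinched K' r₁ E x := by
  obtain ⟨ν, hν, h⟩ := h
  refine ⟨ν, hν, fun z hz => ?_⟩
  have hle : K * ‖z‖ ^ 2 ≤ K' * ‖z‖ ^ 2 := by gcongr
  exact ⟨fun hlt => (h z (hz.trans_le hr)).1 (by linarith),
    fun hlt => (h z (hz.trans_le hr)).2 (by linarith)⟩

/-- The two balls touch at `x` from opposite sides, and `|z - c| < R` means `|z|² < 2⟨z, c⟩` when
`|c| = R`. This gives `K = 1/(2R)` at every scale `r₀`. -/
theorem BallCondition.pinched {R : ℝ} (hR : 0 < R) (h : BallCondition R E x) (r₀ : ℝ) :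
    Pinched (1 / (2 * R)) r₀ E x := by
  obtain ⟨⟨a, hxa, ha⟩, ⟨b, hxb, hb⟩⟩ := h
  set p := a - x with hp
  set q := b - x with hq
  have hpn : ‖p‖ = R := by rw [hp, ← dist_eq_norm, dist_comm, hxa]
  have hqn : ‖q‖ = R := by rw [hq, ← dist_eq_norm, dist_comm, hxb]
  -- If the centres were not antipodal about `x`, the parallelogram law would put them at distance
  -- less than `2R`, and their midpoint would lie in both balls.
  have hsum : p + q = 0 := by
    by_contra hne
    have hpos : 0 < ‖p + q‖ := norm_pos_iff.2 hne
    have hpar := parallelogram_law_with_norm ℝ p q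
    have hlt : ‖p - q‖ < 2 * R := by
      refine lt_of_pow_lt_pow_left₀ 2 (by positivity) ?_
      nlinarith
    have hA : midpoint ℝ a b ∈ Metric.ball a R := by
      rw [Metric.mem_ball, dist_midpoint_left, dist_eq_norm, show a - b = p - q by simp [p, q]]
      norm_num
      linarith
    have hB : midpoint ℝ a b ∈ Metric.ball b R := by
      rw [Metric.mem_ball, dist_midpoint_right, dist_eq_norm, show a - b = p - q by simp [p, q]]
      norm_num
      linarith
    exact hb hB (ha hA)
  have hpq : p = -q := eq_neg_of_add_eq_zero_left hsum
  have key : ∀ z c : Rd d, ‖c‖ = R → ‖z‖ ^ 2 < 2 * inner ℝ z c → ‖z - c‖ < R := by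
    intro z c hc hlt
    refine lt_of_pow_lt_pow_left₀ 2 hR.le ?_
    rw [norm_sub_sq_real, hc]
    linarith
  have hpin : Pinched (1 / 2 / R) r₀ E x := by
    refine pinched_of_vector hR hqn.ge (by norm_num) fun z _ => ⟨fun hlt => ?_, fun hlt => ?_⟩
    · refine hb ?_
      rw [mem_ball_iff_norm, show x + z - b = z - q by simp only [q]; abel]
      exact key z q hqn (by linarith)
    · refine ha ?_
      rw [mem_ball_iff_norm, show x + z - a = z - p by simp only [p]; abel]
      refine key z p hpn ?_
      rw [hpq, inner_neg_right]
      linarith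
  rwa [div_div] at hpin

theorem ClassC.isClosed (hE : E ∈ ClassC d) : IsClosed E := by
  obtain ⟨U, -, -, -, rfl⟩ := hE
  exact isClosed_closure

/-- Second order Taylor estimate for a function with locally Lipschitz derivative. -/
theorem exists_taylor_bound {g : Rd d → ℝ} {p : Rd d} (hg : ContDiffAt ℝ 2 g p) :
    ∃ M ≥ 0, ∃ r > 0, ∀ q z, dist q p < r → ‖z‖ < r →
      |g (q + z) - g q - fderiv ℝ g q z| ≤ M * ‖z‖ ^ 2 := by
  have h1 : ContDiffAt ℝ 1 (fderiv ℝ g) p := hg.fderiv_right (by norm_num)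
  obtain ⟨M, t, ht, hM⟩ := h1.exists_lipschitzOnWith
  have hd : ∀ᶠ y in 𝓝 p, DifferentiableAt ℝ g y :=
    (hg.eventually (by simp)).mono fun y hy => hy.differentiableAt (by norm_num)
  obtain ⟨r, hr, hball⟩ := Metric.mem_nhds_iff.1 (inter_mem ht hd)
  refine ⟨M, M.2, r / 2, by positivity, fun q z hq hz => ?_⟩
  have hsub : Metric.closedBall q ‖z‖ ⊆ Metric.ball p r := by
    intro y hy
    rw [Metric.mem_closedBall] at hy
    rw [Metric.mem_ball]
    linarith [dist_triangle y q p]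
  have hqb : q ∈ Metric.closedBall q ‖z‖ := Metric.mem_closedBall_self (norm_nonneg _)
  have := (convex_closedBall q ‖z‖).norm_image_sub_le_of_norm_fderiv_le' (𝕜 := ℝ) (f := g)
    (C := M * ‖z‖) (φ := fderiv ℝ g q) (x := q) (y := q + z)
    (fun y hy => (hball (hsub hy)).2) (fun y hy => ?_) hqb (by simp)
  · rw [add_sub_cancel_left] at this
    calc _ ≤ _ := this
      _ = _ := by ring
  · refine (hM.norm_sub_le (hball (hsub hy)).1 (hball (hsub hqb)).1).trans ?_
    have : ‖y - q‖ ≤ ‖z‖ := by rwa [← dist_eq_norm]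
    gcongr

/-- The gradient of `g` at `q` is the normal direction, and Taylor's formula fixes the sign of `g`
off a slab. The Taylor constant and the lower bound on the gradient are common to all `q` near `p`;
this local uniformity is what (C) needs. -/
theorem ClassC.exists_pinched (hE : E ∈ ClassC d) {p : Rd d} (hp : p ∈ frontier E) :
    ∃ K ≥ 0, ∃ r₀ > 0, ∀ᶠ q in 𝓝 p, q ∈ frontier E → Pinched K r₀ E q := by
  obtain ⟨U, hU, -, hC2, rfl⟩ := hE
  have hfr : frontier (closure U) ⊆ frontier U := frontier_closure_subset
  obtain ⟨g, hg, hg0, hUg⟩ := hC2 p (hfr hp)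
  obtain ⟨M, hM, r, hr, htay⟩ := exists_taylor_bound hg
  have hcont : ∀ᶠ y in 𝓝 p, ContinuousAt g y :=
    (hg.eventually (by simp)).mono fun y hy => hy.continuousAt
  obtain ⟨s, hs, hball⟩ := Metric.eventually_nhds_iff_ball.1 (hUg.and hcont)
  have hm : 0 < ‖fderiv ℝ g p‖ := norm_pos_iff.2 hg0
  have hdc : ContinuousAt (fderiv ℝ g) p :=
    (hg.fderiv_right (m := 1) (by norm_num)).continuousAt
  have hnorm : ∀ᶠ q in 𝓝 p, ‖fderiv ℝ g p‖ / 2 < ‖fderiv ℝ g q‖ :=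
    hdc.norm.eventually (lt_mem_nhds (by linarith))
  refine ⟨M / (‖fderiv ℝ g p‖ / 2), by positivity, min r (s / 2), by positivity, ?_⟩
  filter_upwards [hnorm, Metric.ball_mem_nhds p (lt_min hr (half_pos hs))] with q hq hqp hqE
  have hqp' : dist q p < min r (s / 2) := hqp
  have hqs : q ∈ Metric.ball p s := by
    rw [Metric.mem_ball]
    linarith [min_le_right r (s / 2)]
  obtain ⟨hqU, hqc⟩ := hball q hqs
  have hqfr := hfr hqE
  have hgq : g q = 0 := by
    refine le_antisymm ?_ ?_
    · by_contra! hlt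
      have hev : ∀ᶠ y in 𝓝 q, y ∉ U := by
        filter_upwards [hqc.eventually (lt_mem_nhds hlt), Metric.isOpen_ball.mem_nhds hqs]
          with y hy hys hyU
        exact absurd ((hball y hys).1.1 hyU) hy.not_gt
      exact mem_closure_iff_frequently.1 hqfr.1 hev
    · by_contra! hlt
      exact hqfr.2 (by rw [hU.interior_eq]; exact hqU.2 hlt)
  refine pinched_of_vector (v := (InnerProductSpace.toDual ℝ (Rd d)).symm (fderiv ℝ g q))
    (by positivity) (by simpa using hq.le) hM fun z hz => ?_
  rw [real_inner_comm, InnerProductSpace.toDual_symm_apply]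
  have hzs : q + z ∈ Metric.ball p s := by
    rw [Metric.mem_ball]
    have := dist_triangle (q + z) q p
    rw [dist_self_add_left] at this
    linarith [min_le_right r (s / 2)]
  have ht := htay q z (hqp'.trans_le (min_le_left _ _)) (hz.trans_le (min_le_left _ _))
  rw [hgq, abs_le] at ht
  obtain ⟨hzU, hzc⟩ := hball _ hzs
  constructor
  · intro hlt hmem
    have hpos : 0 < g (q + z) := by linarith
    -- Membership is in the closure of `U`, so `g > 0` is needed on a whole neighbourhood of `q +
    -- z`.
    have hev : ∀ᶠ y in 𝓝 (q + z), y ∉ U := by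
      filter_upwards [hzc.eventually (lt_mem_nhds hpos), Metric.isOpen_ball.mem_nhds hzs]
        with y hy hys hyU
      exact absurd ((hball y hys).1.1 hyU) hy.not_gt
    exact mem_closure_iff_frequently.1 hmem hev
  · intro hlt
    exact subset_closure (hzU.2 (by linarith))

/-- The ball of radius `r/4` about `x + (r/2)ν` stays at height above `r/4` over the tangent plane,
while the slab reaches only `K r² ≤ r/4` once `K r ≤ 1/4`. -/
theorem Pinched.eventually_exists_ball (hK : 0 ≤ K) (hr₀ : 0 < r₀) (h : Pinched K r₀ E x) :
    ∀ᶠ r in 𝓝[>] (0 : ℝ), ∃ q, Metric.ball q (r / 4) ⊆ Metric.closedBall x r \ frontier E := by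
  obtain ⟨ν, hν, h⟩ := h
  have hpos : 0 < min r₀ (1 / (4 * (K + 1))) := lt_min hr₀ (by positivity)
  filter_upwards [Ioo_mem_nhdsGT hpos] with r hr
  have hr0 := hr.1
  have hrr : r < r₀ := hr.2.trans_le (min_le_left _ _)
  have hrK : K * r ≤ 1 / 4 := by
    have := hr.2.le.trans (min_le_right _ _)
    rw [le_div_iff₀ (by positivity)] at this
    linarith
  have hz : ∀ y ∈ Metric.ball (x + (r / 2) • ν) (r / 4), y ∉ E ∧ dist y x ≤ r := by
    intro y hy
    set u := y - (x + (r / 2) • ν) with hu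
    have hun : ‖u‖ < r / 4 := by rwa [hu, ← mem_ball_iff_norm]
    have hy' : y = x + (u + (r / 2) • ν) := by rw [hu]; abel
    have hνn : ‖(r / 2) • ν‖ = r / 2 := by rw [norm_smul, hν, Real.norm_of_nonneg] <;> linarith
    have hn : ‖u + (r / 2) • ν‖ ≤ r := by
      refine (norm_add_le _ _).trans ?_
      rw [hνn]; linarith
    refine ⟨?_, ?_⟩
    · rw [hy']
      refine (h _ (hn.trans_lt hrr)).1 ?_
      have hin : inner ℝ (u + (r / 2) • ν) ν = inner ℝ u ν + r / 2 := by
        rw [inner_add_left, real_inner_smul_left, real_inner_self_eq_norm_sq, hν]; ring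
      have habs := abs_le.1 ((abs_real_inner_le_norm u ν).trans (by rw [hν, mul_one]))
      rw [hin]
      calc K * ‖u + (r / 2) • ν‖ ^ 2 ≤ K * r ^ 2 := by gcongr
        _ = K * r * r := by ring
        _ ≤ 1 / 4 * r := by gcongr
        _ < _ := by linarith [habs.1]
    · rw [hy', dist_self_add_left]
      exact hn
  refine ⟨x + (r / 2) • ν, fun y hy => ⟨(hz y hy).2, fun hyf => ?_⟩⟩
  exact mem_closure_iff_frequently.1 hyf.1
    (eventually_of_mem (Metric.isOpen_ball.mem_nhds hy) fun w hw => (hz w hw).1)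

/-- The missing balls keep the density of the frontier at each of its points at most `1 - 4^{-d}` on
small scales, whereas by Lebesgue's theorem it is `1` at almost all of them. -/
theorem volume_frontier_eq_zero [NeZero d]
    (h : ∀ x ∈ frontier E, ∃ K ≥ 0, ∃ r₀ > 0, Pinched K r₀ E x) :
    volume (frontier E) = 0 := by
  have hmeas : MeasurableSet (frontier E) := isClosed_frontier.measurableSet
  have hae := Besicovitch.ae_tendsto_measure_inter_div (volume : Measure (Rd d)) (frontier E)
  rw [ae_restrict_iff' hmeas] at hae
  refine measure_mono_null (fun x hx => ?_) (ae_iff.1 hae)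
  intro hlim
  obtain ⟨K, hK, r₀, hr₀, hP⟩ := h x hx
  set θ : ℝ≥0∞ := ENNReal.ofReal ((1 / 4) ^ d)
  have hθ : 1 - θ < 1 := ENNReal.sub_lt_self ENNReal.one_ne_top one_ne_zero
    (ENNReal.ofReal_pos.2 (by positivity)).ne'
  obtain ⟨r, ⟨hr1, q, hq⟩, hr0⟩ := (((hlim hx).eventually (lt_mem_nhds hθ)).and
    (hP.eventually_exists_ball hK hr₀)).and self_mem_nhdsWithin |>.exists
  have hr : (0 : ℝ) < r := hr0
  refine absurd hr1 (not_lt.2 ?_)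
  have hBpos : volume (Metric.closedBall x r) ≠ 0 := (Metric.measure_closedBall_pos _ _ hr).ne'
  have hBfin : volume (Metric.closedBall x r) ≠ ∞ := Metric.isBounded_closedBall.measure_lt_top.ne
  have hvol : volume (Metric.ball q (r / 4)) = θ * volume (Metric.closedBall x r) := by
    rw [Measure.addHaar_ball _ q (by positivity), Measure.addHaar_closedBall _ x hr.le,
      ← mul_assoc, ← ENNReal.ofReal_mul (by positivity), finrank_euclideanSpace_fin, ← mul_pow]
    ring_nf
  rw [ENNReal.div_le_iff hBpos hBfin, ENNReal.sub_mul (fun _ _ => hBfin), one_mul, ← hvol]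
  refine le_trans (measure_mono ?_) (measure_sdiff (hq.trans sdiff_subset)
    measurableSet_ball.nullMeasurableSet Metric.isBounded_ball.measure_lt_top.ne).le
  exact fun y hy => ⟨hy.2, fun hyq => (hq hyq).2 hy.1⟩

end PinchedSets

/-! ### Stability of pinching under small `C²` perturbations -/

section Diffeomorphisms

variable {d : ℕ} {E : Set (Rd d)} {x : Rd d} {K r₀ : ℝ}

theorem norm_iteratedFDeriv_le_of_C2Norm_le {f : Rd d → Rd d} {δ : ℝ} (hδ : 0 ≤ δ)
    (h : C2Norm f ≤ ENNReal.ofReal δ) {k : ℕ} (hk : k < 3) (y : Rd d) :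
    ‖iteratedFDeriv ℝ k f y‖ ≤ δ := by
  have h1 : ‖iteratedFDeriv ℝ k f y‖ₑ ≤ C2Norm f :=
    (le_iSup (fun y => ‖iteratedFDeriv ℝ k f y‖ₑ) y).trans
      (Finset.single_le_sum (f := fun k => ⨆ y, ‖iteratedFDeriv ℝ k f y‖ₑ)
        (fun _ _ => zero_le) (Finset.mem_range.2 hk))
  rw [← ofReal_norm] at h1
  exact (ENNReal.ofReal_le_ofReal_iff hδ).1 (h1.trans h)

theorem norm_le_of_C2Norm_le {f : Rd d → Rd d} {δ : ℝ} (hδ : 0 ≤ δ)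
    (h : C2Norm f ≤ ENNReal.ofReal δ) (y : Rd d) : ‖f y‖ ≤ δ := by
  simpa using norm_iteratedFDeriv_le_of_C2Norm_le hδ h (k := 0) (by norm_num) y

theorem norm_fderiv_le_of_C2Norm_le {f : Rd d → Rd d} {δ : ℝ} (hδ : 0 ≤ δ)
    (h : C2Norm f ≤ ENNReal.ofReal δ) (y : Rd d) : ‖fderiv ℝ f y‖ ≤ δ := by
  rw [← norm_iteratedFDeriv_one]
  exact norm_iteratedFDeriv_le_of_C2Norm_le hδ h (k := 1) (by norm_num) y

theorem norm_fderiv_fderiv_le_of_C2Norm_le {f : Rd d → Rd d} {δ : ℝ} (hδ : 0 ≤ δ)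
    (h : C2Norm f ≤ ENNReal.ofReal δ) (y : Rd d) : ‖fderiv ℝ (fderiv ℝ f) y‖ ≤ δ := by
  rw [← norm_iteratedFDeriv_one, norm_iteratedFDeriv_fderiv]
  exact norm_iteratedFDeriv_le_of_C2Norm_le hδ h (k := 2) (by norm_num) y

theorem norm_taylor_le_of_C2Norm_le {f : Rd d → Rd d} (hf : ContDiff ℝ 2 f) {δ : ℝ} (hδ : 0 ≤ δ)
    (h : C2Norm f ≤ ENNReal.ofReal δ) (x z : Rd d) :
    ‖f (x + z) - f x - fderiv ℝ f x z‖ ≤ δ * ‖z‖ ^ 2 := by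
  have h1 : ContDiff ℝ 1 (fderiv ℝ f) := hf.fderiv_right (by norm_num)
  have hlip : ∀ a b, ‖fderiv ℝ f b - fderiv ℝ f a‖ ≤ δ * ‖b - a‖ := fun a b =>
    convex_univ.norm_image_sub_le_of_norm_fderiv_le (𝕜 := ℝ)
      (fun y _ => h1.differentiable (by norm_num) y)
      (fun y _ => norm_fderiv_fderiv_le_of_C2Norm_le hδ h y) (mem_univ a) (mem_univ b)
  have := (convex_closedBall x ‖z‖).norm_image_sub_le_of_norm_fderiv_le' (𝕜 := ℝ) (f := f)
    (C := δ * ‖z‖) (φ := fderiv ℝ f x) (x := x) (y := x + z)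
    (fun y _ => hf.differentiable (by norm_num) y) (fun y hy => ?_)
    (Metric.mem_closedBall_self (norm_nonneg _)) (by simp)
  · rw [add_sub_cancel_left] at this
    calc _ ≤ _ := this
      _ = _ := by ring
  · refine (hlip x y).trans ?_
    have : ‖y - x‖ ≤ ‖z‖ := by rw [← dist_eq_norm]; exact hy
    gcongr

theorem exists_apply_eq_of_norm_sub_id_le {T : Rd d →L[ℝ] Rd d}
    (hT : ∀ y, ‖T y - y‖ ≤ 1 / 2 * ‖y‖) (u : Rd d) :
    ∃ v, T v = u ∧ ‖v‖ ≤ 2 * ‖u‖ ∧ ‖u‖ ≤ 2 * ‖v‖ := by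
  have hlow : ∀ y, ‖y‖ ≤ 2 * ‖T y‖ := fun y => by
    have h1 := norm_sub_norm_le y (T y)
    rw [norm_sub_rev] at h1
    linarith [hT y]
  have hinj : Function.Injective (T : Rd d →ₗ[ℝ] Rd d) := by
    refine (injective_iff_map_eq_zero _).2 fun y hy => ?_
    have h0 := hlow y
    rw [show T y = 0 from hy, norm_zero, mul_zero] at h0
    exact norm_le_zero_iff.1 h0
  obtain ⟨v, hv⟩ := LinearMap.injective_iff_surjective.1 hinj u
  have hv' : T v = u := hv
  refine ⟨v, hv', hv' ▸ hlow v, ?_⟩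
  have h1 := norm_sub_norm_le (T v) v
  rw [hv'] at h1
  have := hT v
  rw [hv'] at this
  linarith [norm_nonneg v]

/-- Normals transform by the inverse transpose: with `A = D(Φ - Id)(x)`, the new normal `v` solves
`(1 + Aᵀ)v = ν`. Then `⟨w, v⟩` for the image displacement `w` differs from `⟨z, ν⟩` only by a
quadratic Taylor remainder, at most `|z|²`. Since `|z| ≤ 2|w|` and `|v| ≥ 1/2`, the constant becomes
`2 · 4(K + 1)` and the radius is halved. -/
theorem Pinched.image (hK : 0 ≤ K) (h : Pinched K r₀ E x) (Φ : C2Diffeo d)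
    (hΦ : C2Norm (fun y => Φ y - y) ≤ ENNReal.ofReal (1 / 2)) :
    Pinched (8 * (K + 1)) (r₀ / 2) (Φ '' E) (Φ x) := by
  obtain ⟨ν, hν, h⟩ := h
  set G : Rd d → Rd d := fun y => Φ y - y with hG
  have hGc : ContDiff ℝ 2 G := Φ.contDiff.sub contDiff_id
  have hG1 := norm_fderiv_le_of_C2Norm_le (by norm_num) hΦ
  have hlip : ∀ a b, ‖G b - G a‖ ≤ 1 / 2 * ‖b - a‖ := fun a b =>
    convex_univ.norm_image_sub_le_of_norm_fderiv_le (𝕜 := ℝ)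
      (fun y _ => hGc.differentiable (by norm_num) y) (fun y _ => hG1 y) (mem_univ a) (mem_univ b)
  set A := fderiv ℝ G x
  obtain ⟨v, hTv, hv2, hv1⟩ := exists_apply_eq_of_norm_sub_id_le
    (T := ContinuousLinearMap.id ℝ (Rd d) + ContinuousLinearMap.adjoint A) (fun y => by
      simp only [_root_.add_apply, ContinuousLinearMap.id_apply, add_sub_cancel_left]
      refine (ContinuousLinearMap.le_opNorm _ _).trans ?_
      rw [LinearIsometryEquiv.norm_map]
      exact mul_le_mul_of_nonneg_right (hG1 x) (norm_nonneg _)) ν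
  rw [hν] at hv1 hv2
  have hkey : Pinched (4 * (K + 1) / (1 / 2)) (r₀ / 2) (Φ '' E) (Φ x) := by
    refine pinched_of_vector (v := v) (by norm_num) (by linarith) (by positivity) fun w hw => ?_
    obtain ⟨y, hy⟩ : ∃ y, Φ y = Φ x + w := Φ.surjective _
    obtain ⟨z, rfl⟩ : ∃ z, y = x + z := ⟨y - x, by abel⟩
    have hmem : Φ x + w ∈ Φ '' E ↔ x + z ∈ E := by
      rw [← hy]; exact Φ.injective.mem_set_image
    have hwz : w = z + (G (x + z) - G x) := by
      simp only [hG]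
      rw [hy]; abel
    have hzw : ‖z‖ ≤ 2 * ‖w‖ := by
      have h1 := hlip x (x + z)
      rw [add_sub_cancel_left, show G (x + z) - G x = w - z by rw [hwz]; abel] at h1
      have h2 := norm_sub_norm_le z w
      rw [norm_sub_rev] at h2
      linarith
    have htay := norm_taylor_le_of_C2Norm_le hGc (by norm_num) hΦ x z
    set e := G (x + z) - G x - A z with he
    have hin : inner ℝ w v = inner ℝ z ν + inner ℝ e v := by
      have : w = z + A z + e := by rw [hwz, he]; abel
      rw [this, ← hTv]
      simp only [_root_.add_apply, ContinuousLinearMap.id_apply, inner_add_left,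
        inner_add_right, ContinuousLinearMap.adjoint_inner_right]
    have hev : |inner ℝ e v| ≤ ‖z‖ ^ 2 := by
      refine (abs_real_inner_le_norm e v).trans ?_
      calc ‖e‖ * ‖v‖ ≤ (1 / 2 * ‖z‖ ^ 2) * (2 * 1) := by gcongr
        _ = ‖z‖ ^ 2 := by ring
    have hsq : (K + 1) * ‖z‖ ^ 2 ≤ 4 * (K + 1) * ‖w‖ ^ 2 := by
      calc (K + 1) * ‖z‖ ^ 2 ≤ (K + 1) * (2 * ‖w‖) ^ 2 := by gcongr
        _ = _ := by ring
    have hz := h z (by linarith)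
    rw [abs_le] at hev
    rw [hmem, hin]
    exact ⟨fun hlt => hz.1 (by linarith), fun hlt => hz.2 (by linarith)⟩
  convert hkey using 1
  ring

end Diffeomorphisms

/-! ### Change of variables in `L¹` near the identity -/

section ChangeOfVariables

variable {d : ℕ} {S : Rd d → Rd d} {S' : Rd d → Rd d →L[ℝ] Rd d}

theorem integrable_abs_det_mul_comp (hS : ∀ z, HasFDerivAt S (S' z) z)
    (hbij : Function.Bijective S) {g : Rd d → ℝ} (hg : Integrable g) :
    Integrable fun z => |(S' z).det| * g (S z) := by
  have h := integrableOn_image_iff_integrableOn_abs_det_fderiv_smul volume MeasurableSet.univ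
    (fun z _ => (hS z).hasFDerivWithinAt) hbij.1.injOn g
  rw [image_univ, hbij.2.range_eq, integrableOn_univ, integrableOn_univ] at h
  exact h.1 hg

theorem integral_abs_det_mul_comp (hS : ∀ z, HasFDerivAt S (S' z) z)
    (hbij : Function.Bijective S) (g : Rd d → ℝ) :
    ∫ z, |(S' z).det| * g (S z) = ∫ z, g z := by
  have h := integral_image_eq_integral_abs_det_fderiv_smul volume MeasurableSet.univ
    (fun z _ => (hS z).hasFDerivWithinAt) hbij.1.injOn g
  rw [image_univ, hbij.2.range_eq, setIntegral_univ, setIntegral_univ] at h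
  exact h.symm

/-- Continuity in `L¹` of the change of variables along maps `C¹`-close to the identity. -/
theorem exists_integral_abs_sub_abs_det_mul_comp_le {ψ : Rd d → ℝ} (hψ : Integrable ψ) {ε : ℝ}
    (hε : 0 < ε) :
    ∃ δ > 0, ∀ (S : Rd d → Rd d) (S' : Rd d → Rd d →L[ℝ] Rd d),
      (∀ z, HasFDerivAt S (S' z) z) → Function.Bijective S → (∀ z, ‖S z - z‖ ≤ δ) →
      (∀ z, ‖S' z - ContinuousLinearMap.id ℝ (Rd d)‖ ≤ δ) →
        ∫ z, |ψ z - |(S' z).det| * ψ (S z)| ≤ ε := by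
  -- `ψ` is replaced by a continuous compactly supported `g`. The change of variables makes the
  -- error `∫ |det S'| |ψ∘S - g∘S|` equal to `∫ |ψ - g|`, so the approximation is paid for twice.
  obtain ⟨g, hgc, hgψ, hgcont, hgint⟩ :=
    hψ.exists_hasCompactSupport_integral_sub_le (show 0 < ε / 4 by positivity)
  obtain ⟨M, hM⟩ := hgcont.bounded_above_of_compact_support hgc
  have hM0 : 0 ≤ M := (norm_nonneg _).trans (hM 0)
  obtain ⟨R, hR⟩ := hgc.isCompact.isBounded.subset_closedBall (0 : Rd d)
  -- `S` moves points by at most `1`, so both `g` and `g ∘ S` vanish off this enlarged ball.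
  set B : Set (Rd d) := Metric.closedBall 0 (R + 1)
  set V := volume.real B
  have hV : 0 ≤ V := measureReal_nonneg
  set η := ε / (4 * (2 + M) * (V + 1)) with hη
  have hη0 : 0 < η := by positivity
  obtain ⟨δ₁, hδ₁, hu⟩ := Metric.uniformContinuous_iff.1
    (hgc.uniformContinuous_of_continuous hgcont) η hη0
  have hdet : ∀ᶠ A : Rd d →L[ℝ] Rd d in 𝓝 (ContinuousLinearMap.id ℝ (Rd d)),
      dist |A.det| 1 < min η 1 := by
    have hc : Tendsto (fun A : Rd d →L[ℝ] Rd d => |A.det|) (𝓝 (ContinuousLinearMap.id ℝ (Rd d)))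
        (𝓝 |(ContinuousLinearMap.id ℝ (Rd d)).det|) :=
      (ContinuousLinearMap.continuous_det.tendsto _).abs
    have h1 : |(ContinuousLinearMap.id ℝ (Rd d)).det| = 1 := by
      simp [ContinuousLinearMap.det]
    rw [h1] at hc
    exact Metric.tendsto_nhds.1 hc _ (lt_min hη0 one_pos)
  obtain ⟨δ₂, hδ₂, hdet⟩ := Metric.eventually_nhds_iff_ball.1 hdet
  refine ⟨min (min (δ₁ / 2) (δ₂ / 2)) 1, by positivity, fun S S' hS hbij hS0 hS1 => ?_⟩
  set J : Rd d → ℝ := fun z => |(S' z).det|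
  have hJ : ∀ z, |J z - 1| ≤ η ∧ |J z| ≤ 2 := fun z => by
    have hmem : S' z ∈ Metric.ball (ContinuousLinearMap.id ℝ (Rd d)) δ₂ := by
      rw [mem_ball_iff_norm]
      linarith [hS1 z, min_le_left (min (δ₁ / 2) (δ₂ / 2)) 1, min_le_right (δ₁ / 2) (δ₂ / 2)]
    have hlt := hdet _ hmem
    rw [Real.dist_eq] at hlt
    have h1 := hlt.le.trans (min_le_left _ _)
    have h2 := abs_le.1 (hlt.le.trans (min_le_right _ _))
    exact ⟨h1, abs_le.2 ⟨by linarith [h2.1], by linarith [h2.2]⟩⟩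
  have hout : ∀ z, z ∉ Metric.closedBall (0 : Rd d) R → g z = 0 := fun z hz =>
    image_eq_zero_of_notMem_tsupport fun h => hz (hR h)
  have hmid : ∀ z, |g z - J z * g (S z)| ≤ B.indicator (fun _ => η * (2 + M)) z := by
    intro z
    by_cases hz : z ∈ B
    · rw [Set.indicator_of_mem hz]
      have h1 : |g z - g (S z)| ≤ η := by
        rw [← Real.dist_eq]
        refine (hu ?_).le
        rw [dist_comm, dist_eq_norm]
        linarith [hS0 z, min_le_left (min (δ₁ / 2) (δ₂ / 2)) 1, min_le_left (δ₁ / 2) (δ₂ / 2)]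
      have h2 : |g z| ≤ M := hM z
      calc |g z - J z * g (S z)| = |J z * (g z - g (S z)) - (J z - 1) * g z| := by ring_nf
        _ ≤ |J z| * |g z - g (S z)| + |J z - 1| * |g z| := by
            rw [← abs_mul, ← abs_mul]; exact abs_sub _ _
        _ ≤ 2 * η + η * M := by
            have := hJ z
            gcongr
            exacts [this.2, this.1]
        _ = η * (2 + M) := by ring
    · have hz' : R + 1 < ‖z‖ := by simpa [B] using hz
      have h1 : g z = 0 := hout z (by simp; linarith)
      have h2 : g (S z) = 0 := hout _ (by
        have h3 := norm_sub_norm_le z (S z)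
        rw [norm_sub_rev] at h3
        have h4 := (hS0 z).trans (min_le_right _ _)
        simp
        linarith)
      rw [h1, h2, Set.indicator_of_notMem hz]; simp
  have hBfin : volume B ≠ ∞ := Metric.isBounded_closedBall.measure_lt_top.ne
  have hBm : MeasurableSet B := Metric.isClosed_closedBall.measurableSet
  have hI1 : Integrable fun z => |ψ z - g z| := (hψ.sub hgint).abs
  have hI2 : Integrable (B.indicator fun _ : Rd d => η * (2 + M)) :=
    (integrableOn_const hBfin).integrable_indicator hBm
  have hI3 : Integrable fun z => J z * |ψ (S z) - g (S z)| :=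
    integrable_abs_det_mul_comp hS hbij hI1
  have hgψ' : ∫ z, |ψ z - g z| ≤ ε / 4 := hgψ
  calc ∫ z, |ψ z - J z * ψ (S z)|
      ≤ ∫ z, (|ψ z - g z| + B.indicator (fun _ => η * (2 + M)) z) +
          J z * |ψ (S z) - g (S z)| := by
        refine integral_mono (hψ.sub (integrable_abs_det_mul_comp hS hbij hψ)).abs
          ((hI1.add hI2).add hI3) fun z => ?_
        have h1 : J z * |ψ (S z) - g (S z)| = |J z * (ψ (S z) - g (S z))| := by
          rw [abs_mul, abs_of_nonneg (abs_nonneg (S' z).det : 0 ≤ J z)]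
        have h2 : ψ z - J z * ψ (S z) =
            (ψ z - g z) + (g z - J z * g (S z)) - J z * (ψ (S z) - g (S z)) := by ring
        simp only
        rw [h1, h2]
        refine (abs_sub _ _).trans (add_le_add_left ((abs_add_le _ _).trans ?_) _)
        exact add_le_add_right (hmid z) _
    _ = (∫ z, |ψ z - g z|) + η * (2 + M) * V + ∫ z, |ψ z - g z| := by
        have hI12 : Integrable fun z => |ψ z - g z| + B.indicator (fun _ => η * (2 + M)) z :=
          hI1.add hI2
        rw [integral_add hI12 hI3, integral_add hI1 hI2, integral_indicator_const _ hBm,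
          integral_abs_det_mul_comp hS hbij fun z => |ψ z - g z|]
        simp only [smul_eq_mul, V]; ring
    _ ≤ ε / 4 + ε / 4 + ε / 4 := by
        have : η * (2 + M) * V ≤ ε / 4 := by
          calc η * (2 + M) * V ≤ η * (2 + M) * (V + 1) := by
                gcongr; linarith
            _ = ε / 4 := by rw [hη]; field_simp
        gcongr
    _ ≤ ε := by linarith

end ChangeOfVariables

/-! ### Continuity of the curvature -/

section Continuity

variable {d : ℕ} {j φ : Rd d → ℝ} {E : Set (Rd d)} {x : Rd d} {K r₀ : ℝ}

/-- A family of quantities `b i` which is uniformly small when `a i` is small is controlled by a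
modulus of continuity. -/
theorem exists_isModulus {ι : Type*} {a b : ι → ℝ≥0∞}
    (h : ∀ ε : ℝ, 0 < ε → ∃ δ : ℝ, 0 < δ ∧
      ∀ i, a i ≤ ENNReal.ofReal δ → b i ≤ ENNReal.ofReal ε) :
    ∃ ω, IsModulus ω ∧ ∀ i, b i ≤ ω (a i) := by
  have hmono : Monotone fun t => ⨆ i, ⨆ _ : a i ≤ t, b i := fun s t hst =>
    iSup_mono fun i => iSup_le fun hi => le_iSup_of_le (hi.trans hst) le_rfl
  have hlim : Tendsto (fun t => ⨆ i, ⨆ _ : a i ≤ t, b i) (𝓝 0) (𝓝 0) := by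
    refine ENNReal.tendsto_nhds_zero.2 fun ε hε => ?_
    obtain ⟨e, he, hle⟩ : ∃ e : ℝ, 0 < e ∧ ENNReal.ofReal e ≤ ε := by
      obtain ⟨e, he0, he⟩ := ENNReal.lt_iff_exists_nnreal_btwn.1 hε
      exact ⟨e, by exact_mod_cast he0, by rw [ENNReal.ofReal_coe_nnreal]; exact he.le⟩
    obtain ⟨δ, hδ, hab⟩ := h e he
    filter_upwards [ge_mem_nhds (ENNReal.ofReal_pos.2 hδ)] with t ht
    exact iSup₂_le fun i hi => (hab i (hi.trans ht)).trans hle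
  refine ⟨_, ⟨hmono, ?_, hlim⟩, fun i => le_iSup₂_of_le i le_rfl le_rfl⟩
  -- The filter `𝓝 0` includes the point `0`, so the limit `0` forces the value there.
  refine le_antisymm (le_of_forall_gt fun c hc => ?_) zero_le
  exact (hlim.eventually (gt_mem_nhds hc)).self_of_nhds

theorem C2Diffeo.measurableSet_image (Φ : C2Diffeo d) (hE : MeasurableSet E) :
    MeasurableSet (Φ '' E) :=
  Φ.toHomeomorph.measurableEmbedding.measurableSet_image.2 hE

theorem IsKernel.truncCurvature_eq_integral (hφ : IsKernel j φ) (E : Set (Rd d)) (x : Rd d)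
    (r : ℝ) :
    truncCurvature φ x E r =
      (sphereArea (d - 1))⁻¹ * ∫ z, signChi E (x + z) * (Metric.ball 0 r)ᶜ.indicator φ z := by
  rw [hφ.truncCurvature_eq, ← integral_indicator measurableSet_ball.compl]
  congr 2 with z
  by_cases hz : z ∈ (Metric.ball (0 : Rd d) r)ᶜ <;>
    simp only [Set.indicator_of_mem, Set.indicator_of_notMem, hz, not_false_eq_true, mul_zero]

/-- Substituting `w = Φ(x + z) - Φ(x)` turns the sign function of `Φ(E)` into that of `E`. Only the
truncated kernel changes, by a small amount in `L¹`, and signs of modulus one make the bound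
independent of `E`. -/
theorem exists_abs_truncCurvature_image_sub_le [NeZero d] (hj : IsProfile j) (hφ : IsKernel j φ)
    {ρ : ℝ} (hρ : 0 < ρ) {ε : ℝ} (hε : 0 < ε) :
    ∃ δ > 0, ∀ E : Set (Rd d), MeasurableSet E → ∀ (x : Rd d) (Φ : C2Diffeo d),
      C2Norm (fun y => Φ y - y) ≤ ENNReal.ofReal δ →
        |truncCurvature φ x E ρ - truncCurvature φ (Φ x) (Φ '' E) ρ| ≤ ε := by
  set c := (sphereArea (d - 1))⁻¹
  have hc : 0 ≤ c := sphereArea_inv_nonneg _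
  set ψ : Rd d → ℝ := (Metric.ball 0 ρ)ᶜ.indicator φ
  have hψ : Integrable ψ := (hφ.integrableOn hj hρ).integrable_indicator measurableSet_ball.compl
  obtain ⟨δ, hδ, h⟩ := exists_integral_abs_sub_abs_det_mul_comp_le hψ
    (show 0 < ε / (c + 1) by positivity)
  -- The displacement `Φ(x + z) - Φ(x) - z` is a difference of two values of `Φ - Id`, hence the
  -- half.
  refine ⟨δ / 2, by positivity, fun E hE x Φ hΦ => ?_⟩
  set G : Rd d → Rd d := fun y => Φ y - y with hG
  have hΦc : Differentiable ℝ Φ := Φ.contDiff.differentiable (by norm_num)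
  have hS : ∀ z, HasFDerivAt (fun z => Φ (x + z) - Φ x) (fderiv ℝ Φ (x + z)) z := fun z =>
    ((hasFDerivAt_comp_add_left x).2 (hΦc (x + z)).hasFDerivAt).sub_const _
  have hbij : Function.Bijective fun z => Φ (x + z) - Φ x :=
    (Equiv.subRight (Φ x)).bijective.comp (Φ.bijective.comp (Equiv.addLeft x).bijective)
  have hG0 := norm_le_of_C2Norm_le (by positivity) hΦ
  have h0 : ∀ z, ‖Φ (x + z) - Φ x - z‖ ≤ δ := fun z => by
    have : Φ (x + z) - Φ x - z = G (x + z) - G x := by simp only [hG]; abel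
    rw [this]
    exact (norm_sub_le _ _).trans (by linarith [hG0 (x + z), hG0 x])
  have h1 : ∀ z, ‖fderiv ℝ Φ (x + z) - ContinuousLinearMap.id ℝ (Rd d)‖ ≤ δ := fun z => by
    have : fderiv ℝ G (x + z) = fderiv ℝ Φ (x + z) - ContinuousLinearMap.id ℝ (Rd d) :=
      ((hΦc _).hasFDerivAt.sub (hasFDerivAt_id _)).fderiv
    rw [← this]
    exact (norm_fderiv_le_of_C2Norm_le (by positivity) hΦ _).trans (by linarith)
  have hL1 := h _ _ hS hbij h0 h1
  have hcov := integral_abs_det_mul_comp hS hbij fun w => signChi (Φ '' E) (Φ x + w) * ψ w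
  have hsign : ∀ z, signChi (Φ '' E) (Φ x + (Φ (x + z) - Φ x)) = signChi E (x + z) := fun z => by
    rw [add_sub_cancel]
    have hiff : Φ (x + z) ∈ Φ '' E ↔ x + z ∈ E := Φ.injective.mem_set_image
    by_cases hz : x + z ∈ E
    · rw [signChi_of_mem hz, signChi_of_mem (hiff.2 hz)]
    · rw [signChi_of_notMem hz, signChi_of_notMem (mt hiff.1 hz)]
  simp only [hsign] at hcov
  have hsm : AEStronglyMeasurable (fun z => signChi E (x + z)) volume :=
    ((measurable_signChi hE).comp (measurable_const_add x)).aestronglyMeasurable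
  have hbd : ∀ᵐ z, ‖signChi E (x + z)‖ ≤ 1 := ae_of_all _ fun z => (abs_signChi E _).le
  have hJψ := integrable_abs_det_mul_comp hS hbij hψ
  rw [hφ.truncCurvature_eq_integral, hφ.truncCurvature_eq_integral, ← mul_sub, ← hcov, abs_mul,
    abs_of_nonneg hc]
  have hre : ∀ z, |(fderiv ℝ Φ (x + z)).det| * (signChi E (x + z) * ψ (Φ (x + z) - Φ x)) =
      signChi E (x + z) * (|(fderiv ℝ Φ (x + z)).det| * ψ (Φ (x + z) - Φ x)) := fun z => by ring
  simp only [hre]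
  rw [← integral_sub (hψ.bdd_mul hsm hbd) (hJψ.bdd_mul hsm hbd)]
  calc c * |∫ z, signChi E (x + z) * ψ z -
          signChi E (x + z) * (|(fderiv ℝ Φ (x + z)).det| * ψ (Φ (x + z) - Φ x))|
      ≤ c * ∫ z, |ψ z - |(fderiv ℝ Φ (x + z)).det| * ψ (Φ (x + z) - Φ x)| := by
        refine mul_le_mul_of_nonneg_left (abs_integral_le_integral_abs.trans (le_of_eq ?_)) hc
        congr 1 with z
        rw [← mul_sub, abs_mul, abs_signChi, one_mul]
    _ ≤ (c + 1) * (ε / (c + 1)) := by gcongr; linarith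
    _ = ε := by field_simp

/-- The curvature of a pinched set changes little under diffeomorphisms `C²`-close to the
identity. -/
theorem exists_abs_curvature_image_sub_le [NeZero d] (hj : IsProfile j) (hφ : IsKernel j φ)
    (hK : 0 ≤ K) (hr₀ : 0 < r₀) {ε : ℝ} (hε : 0 < ε) :
    ∃ δ > 0, ∀ E : Set (Rd d), MeasurableSet E → ∀ x, Pinched K r₀ E x → ∀ Φ : C2Diffeo d,
      C2Norm (fun y => Φ y - y) ≤ ENNReal.ofReal δ →
        |curvature φ x E - curvature φ (Φ x) (Φ '' E)| ≤ ε := by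
  -- The radius is chosen for the weaker constants of `Pinched.image`, so it serves both `E` and its
  -- image.
  obtain ⟨ρ, hρ, hnear⟩ := exists_abs_curvature_sub_truncCurvature_le hj hφ
    (show 0 ≤ 8 * (K + 1) by positivity) (half_pos hr₀) (show 0 < ε / 3 by positivity)
  obtain ⟨δ, hδ, hfar⟩ := exists_abs_truncCurvature_image_sub_le hj hφ hρ
    (show 0 < ε / 3 by positivity)
  refine ⟨min δ (1 / 2), by positivity, fun E hE x hP Φ hΦ => ?_⟩
  have h1 := hnear E hE x (hP.mono (by linarith) (by linarith))
  have h2 := hnear _ (C2Diffeo.measurableSet_image Φ hE) _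
    (hP.image hK Φ (hΦ.trans (ENNReal.ofReal_le_ofReal (min_le_right _ _))))
  have h3 := hfar E hE x Φ (hΦ.trans (ENNReal.ofReal_le_ofReal (min_le_left _ _)))
  rw [abs_le] at *
  constructor <;> linarith

theorem eventually_signChi_eq {y : Rd d} (hy : y ∉ frontier E) :
    ∀ᶠ z in 𝓝 y, signChi E z = signChi E y := by
  by_cases hyE : y ∈ E
  · have hint : y ∈ interior E := by
      by_contra hn
      exact hy ⟨subset_closure hyE, hn⟩
    filter_upwards [mem_interior_iff_mem_nhds.1 hint] with z hz
    rw [signChi_of_mem hz, signChi_of_mem hyE]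
  · have hcl : y ∉ closure E := fun hcl => hy ⟨hcl, fun hi => hyE (interior_subset hi)⟩
    filter_upwards [isClosed_closure.isOpen_compl.mem_nhds hcl] with z hz
    rw [signChi_of_notMem fun h => hz (subset_closure h), signChi_of_notMem hyE]

theorem tendsto_of_tendsto_apply {Φ : ℕ → C2Diffeo d}
    (hΦ : Tendsto (fun n => C2Norm (fun y => Φ n y - y)) atTop (𝓝 0)) {a : ℕ → Rd d} {b : Rd d}
    (h : Tendsto (fun n => Φ n (a n)) atTop (𝓝 b)) : Tendsto a atTop (𝓝 b) := by
  have h0 : Tendsto (fun n => Φ n (a n) - a n) atTop (𝓝 0) := by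
    refine Metric.tendsto_nhds.2 fun ε hε => ?_
    filter_upwards [hΦ.eventually (ge_mem_nhds (ENNReal.ofReal_pos.2 (half_pos hε)))] with n hn
    rw [dist_zero_right]
    exact (norm_le_of_C2Norm_le (half_pos hε).le hn (a n)).trans_lt (half_lt_self hε)
  simpa using h.sub h0

/-- Dominated convergence with majorant `φ`: the preimage of `x_n + z` under `Φ_n` tends to `x + z`,
so the sign is eventually constant unless `x + z` lies on the null set `∂E`. -/
theorem tendsto_truncCurvature_image [NeZero d] (hj : IsProfile j) (hφ : IsKernel j φ)
    (hE : MeasurableSet E) (hE0 : volume (frontier E) = 0) {Φ : ℕ → C2Diffeo d}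
    (hΦ : Tendsto (fun n => C2Norm (fun y => Φ n y - y)) atTop (𝓝 0)) {xn : ℕ → Rd d}
    (hx : Tendsto xn atTop (𝓝 x)) {ρ : ℝ} (hρ : 0 < ρ) :
    Tendsto (fun n => truncCurvature φ (xn n) (Φ n '' E) ρ) atTop
      (𝓝 (truncCurvature φ x E ρ)) := by
  simp only [hφ.truncCurvature_eq]
  refine Tendsto.const_mul _ (tendsto_integral_of_dominated_convergence φ (fun n => ?_)
    (hφ.integrableOn hj hρ) (fun n => ae_of_all _ fun z => ?_) ?_)
  · exact (integrableOn_signChi_mul hj hφ (C2Diffeo.measurableSet_image (Φ n) hE) _ hρ).1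
  · rw [norm_mul, Real.norm_eq_abs, abs_signChi, one_mul, Real.norm_of_nonneg (hφ.nonneg z)]
  · refine ae_restrict_of_ae ?_
    have hae : ∀ᵐ z, x + z ∉ frontier E :=
      measure_eq_zero_iff_ae_notMem.1
        ((measurePreserving_add_left volume x).quasiMeasurePreserving.preimage_null hE0)
    filter_upwards [hae] with z hz
    refine Tendsto.mul_const _ ?_
    have hinv : Tendsto (fun n => (Φ n).symm (xn n + z)) atTop (𝓝 (x + z)) :=
      tendsto_of_tendsto_apply hΦ (by simpa using hx.add_const z)
    refine tendsto_const_nhds.congr' ?_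
    filter_upwards [hinv.eventually (eventually_signChi_eq hz)] with n hn
    rw [← hn]
    have hiff : xn n + z ∈ Φ n '' E ↔ (Φ n).symm (xn n + z) ∈ E := by
      conv_lhs => rw [← (Φ n).apply_symm_apply (xn n + z)]
      exact (Φ n).injective.mem_set_image
    by_cases hm : (Φ n).symm (xn n + z) ∈ E
    · rw [signChi_of_mem hm, signChi_of_mem (hiff.2 hm)]
    · rw [signChi_of_notMem hm, signChi_of_notMem (mt hiff.1 hm)]

theorem ClassC.tendsto_curvature_image [NeZero d] (hj : IsProfile j) (hφ : IsKernel j φ)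
    (hE : E ∈ ClassC d) {Φ : ℕ → C2Diffeo d}
    (hΦ : Tendsto (fun n => C2Norm (fun y => Φ n y - y)) atTop (𝓝 0)) {xn : ℕ → Rd d}
    (hxn : ∀ n, xn n ∈ frontier (Φ n '' E)) (hxE : x ∈ frontier E)
    (hx : Tendsto xn atTop (𝓝 x)) :
    Tendsto (fun n => curvature φ (xn n) (Φ n '' E)) atTop (𝓝 (curvature φ x E)) := by
  have hEm : MeasurableSet E := (ClassC.isClosed hE).measurableSet
  have hE0 : volume (frontier E) = 0 := volume_frontier_eq_zero fun y hy => by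
    obtain ⟨K, hK, r₀, hr₀, h⟩ := ClassC.exists_pinched hE hy
    exact ⟨K, hK, r₀, hr₀, h.self_of_nhds hy⟩
  obtain ⟨K, hK, r₀, hr₀, hP⟩ := ClassC.exists_pinched hE hxE
  -- The preimages `y n` are boundary points of `E` converging to `x`; they are eventually pinched
  -- with the constants found at `x`, and `Pinched.image` carries this to `xn n`.
  have hy : ∀ n, ∃ y ∈ frontier E, Φ n y = xn n := fun n => by
    have h := hxn n
    rw [← Diffeomorph.coe_toHomeomorph, ← Homeomorph.image_frontier] at h
    exact h
  choose y hyE hyx using hy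
  have hylim : Tendsto y atTop (𝓝 x) := tendsto_of_tendsto_apply hΦ (by simpa only [hyx] using hx)
  refine Metric.tendsto_nhds.2 fun ε hε => ?_
  obtain ⟨ρ, hρ, hnear⟩ := exists_abs_curvature_sub_truncCurvature_le hj hφ
    (show 0 ≤ 8 * (K + 1) by positivity) (half_pos hr₀) (show 0 < ε / 4 by positivity)
  have hfar := Metric.tendsto_nhds.1
    (tendsto_truncCurvature_image hj hφ hEm hE0 hΦ hx hρ) (ε / 4) (by positivity)
  have h1 := hnear E hEm x ((hP.self_of_nhds hxE).mono (by linarith) (by linarith))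
  filter_upwards [hfar, hylim.eventually hP,
    hΦ.eventually (ge_mem_nhds (ENNReal.ofReal_pos.2 (show (0 : ℝ) < 1 / 2 by norm_num)))]
    with n hn hPn hΦn
  have h2 := hnear _ (C2Diffeo.measurableSet_image (Φ n) hEm) _ ((hPn (hyE n)).image hK (Φ n) hΦn)
  rw [hyx] at h2
  rw [Real.dist_eq] at hn ⊢
  rw [abs_lt] at hn ⊢
  rw [abs_le] at h1 h2
  constructor <;> linarith

end Continuity

end NonlocalCurvature

/-! ### The main statement -/

open NonlocalCurvature
theorem proposition3p1 (d : ℕ) (hd : 2 ≤ d) (j φ : Rd d → ℝ)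
    (hj : IsProfile j) (hφ : IsKernel j φ) :
    -- the curvature is well defined: the integrals converge and the limit exists
    (∀ E ∈ ClassC d, ∀ x ∈ frontier E,
      (∀ r > 0, IntegrableOn (fun y => signChi E y * φ (x - y)) (Metric.ball x r)ᶜ) ∧
      Tendsto (truncCurvature φ x E) (𝓝[>] 0) (𝓝 (curvature φ x E))) ∧
    -- (M) monotonicity
    (∀ E ∈ ClassC d, ∀ F ∈ ClassC d, E ⊆ F → ∀ x ∈ frontier E ∩ frontier F,
      curvature φ x F ≤ curvature φ x E) ∧
    -- (T) translation invariance
    (∀ E ∈ ClassC d, ∀ x ∈ frontier E, ∀ z : Rd d,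
      curvature φ x E = curvature φ (x + z) ((fun y => y + z) '' E)) ∧
    -- (C') uniform continuity
    (∀ R : ℝ, 0 < R → ∃ ω : ℝ≥0∞ → ℝ≥0∞, IsModulus ω ∧
      ∀ E ∈ ClassC d, ∀ x ∈ frontier E, BallCondition R E x →
        ∀ Φ : C2Diffeo d, (∀ y, 1 ≤ dist y x → Φ y = y) →
          ENNReal.ofReal |curvature φ x E - curvature φ (Φ x) (Φ '' E)| ≤
            ω (C2Norm (fun y => Φ y - y))) ∧
    -- (C) continuity
    (∀ E ∈ ClassC d, ∀ En : ℕ → Set (Rd d), SetTendsto En E →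
      ∀ (xn : ℕ → Rd d) (x : Rd d), (∀ n, xn n ∈ frontier (En n)) → x ∈ frontier E →
        Tendsto xn atTop (𝓝 x) →
        Tendsto (fun n => curvature φ (xn n) (En n)) atTop (𝓝 (curvature φ x E))) := by
  have : NeZero d := ⟨by omega⟩
  have hlim : ∀ E ∈ ClassC d, ∀ x ∈ frontier E,
      Tendsto (truncCurvature φ x E) (𝓝[>] 0) (𝓝 (curvature φ x E)) := fun E hE x hx => by
    obtain ⟨K, hK, r₀, hr₀, hP⟩ := ClassC.exists_pinched hE hx
    exact (hP.self_of_nhds hx).tendsto_truncCurvature hj hφ hK hr₀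
      (ClassC.isClosed hE).measurableSet
  refine ⟨fun E hE x hx => ⟨fun r hr => ?_, hlim E hE x hx⟩, ?_, ?_, ?_, ?_⟩
  · exact integrableOn_signChi_mul_sub hj hφ (ClassC.isClosed hE).measurableSet x hr
  · intro E hE F hF hEF x hx
    refine le_of_tendsto_of_tendsto (hlim F hF x hx.2) (hlim E hE x hx.1) ?_
    filter_upwards [self_mem_nhdsWithin] with r hr
    exact truncCurvature_anti hj hφ (ClassC.isClosed hE).measurableSet
      (ClassC.isClosed hF).measurableSet hEF x hr
  · intro E _ x _ z
    rw [curvature, curvature, truncCurvature_translate]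
  · intro R hR
    -- The supremum defining the modulus runs over all triples `(E, x, Φ)` with `E` pinched at `x`
    -- with constant `1/(2R)`, so it depends only on `R`, `d` and `φ`. The scale `1` is an arbitrary
    -- choice, as the ball condition gives pinching at every scale.
    obtain ⟨ω, hω, h⟩ := exists_isModulus
      (ι := {p : Set (Rd d) × Rd d × C2Diffeo d //
        MeasurableSet p.1 ∧ Pinched (1 / (2 * R)) 1 p.1 p.2.1})
      (a := fun p => C2Norm (fun y => p.1.2.2 y - y))
      (b := fun p => ENNReal.ofReal
        |curvature φ p.1.2.1 p.1.1 - curvature φ (p.1.2.2 p.1.2.1) (p.1.2.2 '' p.1.1)|)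
      fun ε hε => by
        obtain ⟨δ, hδ, h⟩ := exists_abs_curvature_image_sub_le hj hφ
          (show 0 ≤ 1 / (2 * R) by positivity) one_pos hε
        exact ⟨δ, hδ, fun p hp => ENNReal.ofReal_le_ofReal (h _ p.2.1 _ p.2.2 _ hp)⟩
    refine ⟨ω, hω, fun E hE x _ hball Φ _ => ?_⟩
    exact h ⟨(E, x, Φ), (ClassC.isClosed hE).measurableSet, hball.pinched hR 1⟩
  · rintro E hE En ⟨Φ, hΦ, hEn⟩ xn x hxn hx hlimx
    obtain rfl : En = fun n => Φ n '' E := funext hEn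
    exact ClassC.tendsto_curvature_image hj hφ hE hΦ hxn hx hlimx
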